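/- **Theorem.** Let $I$ be a countable index set, let $X$ be a $\sigma$-finite measure space, let $H_0=L^2(X)$ (complex-valued), and let $V_0$ be a complex Hilbert space that is continuously and densely embedded into $H_0$. Put $V=\bigoplus_{i\in I}V_0$ and $H=\bigoplus_{i\in I}H_0$ (Hilbert direct sums), so that $V$ is continuously and densely embedded into $H$ componentwise, and regard elements of $H$ as functions $\psi=(\psi_i)_{i\in I}$ on $X$ with values $\psi(x)=(\psi_i(x))_{i\in I}\in\ell^2(I)$ for almost every $x$. Let $a:V\times V\to\mathbb C$ be a continuous sesquilinear form, linear in the first and antilinear in the second argument, which is $H$-elliptic: there are $\alpha>0$ and $\omega\in\mathbb R$ with $\operatorname{Re}a(\psi,\psi)+\omega\|\psi\|_H^2\ge\alpha\|\psi\|_V^2$ for all $\psi\in V$. Let $a_{ij}:V_0\times V_0\to\mathbb C$ be its matrix entries, that is, $a_{ij}(\psi,\psi')$ is the value of $a$ at the pair consisting of the vector with $j$-th component $\psi$ and the vector with $i$-th component $\psi'$, all other components being $0$. Let $A$ be the operator associated with $a$ in $H$: $\psi\in D(A)$ and $A\psi=-f$ if and only if $\psi\in V$, $f\in H$ and $a(\psi,\psi')=(f\mid\psi')_H$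 for all $\psi'\in V$. Then $A$ generates a strongly continuous semigroup $(e^{ta})_{t\ge0}$ on $H$, and the following holds. Let $Y\subset\ell^2(I)$ be a closed linear subspace and let $$\mathcal Y=\{\psi\in H:\ \psi(x)\in Y\text{ for almost every }x\in X\}.$$ For all orthonormal (Hilbert) bases $(v_\ell)_{\ell\in I'}$ of $Y$ and $(v_k)_{k\in I''}$ of $Y^\perp$, the following are equivalent: a) $\mathcal Y$ is invariant under the semigroup, i.e. $e^{ta}\mathcal Y\subset\mathcal Y$ for all $t\ge0$; b) for all families $(\psi_\ell)_{\ell\in I'}$ and $(\psi'_k)_{k\in I''}$ in $V_0$ with $\sum_{\ell\in I'}\|\psi_\ell\|_{V_0}^2<\infty$ and $\sum_{k\in I''}\|\psi'_k\|_{V_0}^2<\infty$, $$\sum_{i\in I}\sum_{j\in I}\ \sum_{(\ell,k)\in I'\times I''}(v_\ell)_j\,\overline{(v_k)_i}\;a_{ij}(\psi_\ell,\psi'_k)=0,$$ where the sum over $(\ell,k)$, the sum over $j$ and the sum over $i$ each converge unconditionally, taken successively in this order. -/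

import Mathlib

open MeasureTheory Filter Topology
open scoped lp ENNReal NNReal

noncomputable section

namespace FormMatrix

section Abstract

variable {V H : Type*} [NormedAddCommGroup V] [InnerProductSpace ℂ V]
  [NormedAddCommGroup H] [InnerProductSpace ℂ H]

/-- A continuous sesquilinear form `a` on `V` (linear in the first argument, antilinear in the
second) is `H`-elliptic with respect to the embedding `j : V → H` if
`Re a(u, u) + ω ‖u‖_H ^ 2 ≥ α ‖u‖_V ^ 2` for some `α > 0`, `ω ∈ ℝ` and all `u ∈ V`. -/
def IsElliptic (j : V →L[ℂ] H) (a : V →L[ℂ] V →L⋆[ℂ] ℂ) : Prop :=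
  ∃ α : ℝ, 0 < α ∧ ∃ ω : ℝ, ∀ u : V, α * ‖u‖ ^ 2 ≤ (a u u).re + ω * ‖j u‖ ^ 2

/-- The graph of the operator `A` in `H` associated with the form `a`: `x ∈ D(A)` and `A x = y`
if and only if `x = j u` for some `u ∈ V` such that `a(u, w) = (-y | w)_H` for all `w ∈ V`.
The inner product of Mathlib is antilinear in its first argument, so `(f | g)` is
`inner ℂ g f`. -/
def formOperatorGraph (j : V →L[ℂ] H) (a : V →L[ℂ] V →L⋆[ℂ] ℂ) : Set (H × H) :=
  {p | ∃ u : V, j u = p.1 ∧ ∀ w : V, a u w = inner ℂ (j w) (-p.2)}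

/-- `S` is a strongly continuous one-parameter semigroup of bounded operators on `H`. -/
structure IsC0Semigroup (S : ℝ≥0 → H →L[ℂ] H) : Prop where
  map_zero : S 0 = ContinuousLinearMap.id ℂ H
  map_add : ∀ s t : ℝ≥0, S (s + t) = (S s).comp (S t)
  strongly_continuous : ∀ x : H, Continuous fun t : ℝ≥0 => S t x

/-- The graph of the generator of `S`: `x` is in the domain and is mapped to `y` if and only if
`(S t x - x) / t → y` as `t → 0+`. -/
def generatorGraph (S : ℝ≥0 → H →L[ℂ] H) : Set (H × H) :=
  {p | Tendsto (fun t : ℝ≥0 => ((t : ℝ) : ℂ)⁻¹ • (S t p.1 - p.1)) (𝓝[>] 0) (𝓝 p.2)}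

/-- `S` is the semigroup `(e^{ta})_{t ≥ 0}` of the form `a`: the strongly continuous semigroup on
`H` whose generator is exactly the operator associated with `a`. -/
def IsFormSemigroup (j : V →L[ℂ] H) (a : V →L[ℂ] V →L⋆[ℂ] ℂ) (S : ℝ≥0 → H →L[ℂ] H) : Prop :=
  IsC0Semigroup S ∧ generatorGraph S = formOperatorGraph j a

end Abstract

section Sum

variable {I V₀ H₀ : Type*} [NormedAddCommGroup V₀] [InnerProductSpace ℂ V₀]
  [NormedAddCommGroup H₀] [InnerProductSpace ℂ H₀]

/-- The embedding of `V = ⨁_{i ∈ I} V₀` into `H = ⨁_{i ∈ I} H₀` that acts as `φ` in every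
component. The Hilbert direct sums are `ℓ²(I, V₀)` and `ℓ²(I, H₀)`. -/
def sumEmbedding (I : Type*) (φ : V₀ →L[ℂ] H₀) : ℓ²(I, V₀) →L[ℂ] ℓ²(I, H₀) :=
  lp.mapCLM 2 (fun _ : I => φ) (norm_nonneg φ) (fun _ => le_rfl)

@[simp]
theorem sumEmbedding_apply (φ : V₀ →L[ℂ] H₀) (u : ℓ²(I, V₀)) (i : I) :
    sumEmbedding I φ u i = φ (u i) := rfl

open scoped Classical in
/-- The entry `a_{ij}(ψ, ψ')` of the matrix of the form `a`: the value of `a` at the vector with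
`j`-th component `ψ` and the vector with `i`-th component `ψ'`, all other components zero. -/
def formEntry (a : ℓ²(I, V₀) →L[ℂ] ℓ²(I, V₀) →L⋆[ℂ] ℂ) (i j : I) (ψ ψ' : V₀) : ℂ :=
  a (lp.single 2 j ψ) (lp.single 2 i ψ')

/-- The multiple series
`∑_{i,j ∈ I} ∑_{ℓ ∈ L} ∑_{k ∈ K} (v_ℓ)_j conj((w_k)_i) a_{ij}(ψ_ℓ, ψ'_k)` converges to `s`:
for all `i, j` the family over `(ℓ, k)` is summable, with sum `c i j`; for every `i` the family
`j ↦ c i j` is summable, with sum `d i`; and the family `d` is summable with sum `s`. -/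
def HasMatrixSum {L K : Type*} (a : ℓ²(I, V₀) →L[ℂ] ℓ²(I, V₀) →L⋆[ℂ] ℂ)
    (v : L → ℓ²(I, ℂ)) (w : K → ℓ²(I, ℂ)) (ψ : L → V₀) (ψ' : K → V₀) (s : ℂ) : Prop :=
  ∃ (c : I → I → ℂ) (d : I → ℂ),
    (∀ i j : I, HasSum (fun p : L × K =>
      v p.1 j * starRingEnd ℂ (w p.2 i) * formEntry a i j (ψ p.1) (ψ' p.2)) (c i j)) ∧
    (∀ i : I, HasSum (c i) (d i)) ∧ HasSum d s

end Sum

section Valued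

variable {X : Type*} [MeasurableSpace X]

/-- For a subspace `Y` of `ℓ²(I)`, the subspace of all `ψ = (ψ_i)_{i ∈ I}` in
`⨁_{i ∈ I} L²(X, μ)` such that `ψ(x) = (ψ_i(x))_{i ∈ I} ∈ Y` for almost every `x ∈ X`. -/
def valuedIn {I : Type*} [Countable I] (μ : Measure X) (Y : Submodule ℂ ℓ²(I, ℂ)) :
    Submodule ℂ ℓ²(I, Lp ℂ 2 μ) where
  carrier := {ψ | ∀ᵐ x ∂μ, ∃ y ∈ Y, ∀ i : I, (ψ i : X → ℂ) x = y i}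
  zero_mem' := by
    have h : ∀ᵐ x ∂μ, ∀ _i : I, ((0 : Lp ℂ 2 μ) : X → ℂ) x = 0 :=
      ae_all_iff.2 fun _ => Lp.coeFn_zero ℂ 2 μ
    filter_upwards [h] with x hx
    exact ⟨0, Y.zero_mem, hx⟩
  add_mem' := by
    intro ψ χ hψ hχ
    have h : ∀ᵐ x ∂μ, ∀ i : I,
        ((ψ i + χ i : Lp ℂ 2 μ) : X → ℂ) x = (ψ i : X → ℂ) x + (χ i : X → ℂ) x :=
      ae_all_iff.2 fun i => Lp.coeFn_add (ψ i) (χ i)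
    change ∀ᵐ x ∂μ, ∃ y ∈ Y, ∀ i : I, ((ψ i + χ i : Lp ℂ 2 μ) : X → ℂ) x = y i
    filter_upwards [h, hψ, hχ] with x hx hy hz
    obtain ⟨y, hyY, hy⟩ := hy
    obtain ⟨z, hzY, hz⟩ := hz
    refine ⟨y + z, Y.add_mem hyY hzY, fun i => ?_⟩
    have := hx i
    rw [hy i, hz i] at this
    exact this
  smul_mem' := by
    intro r ψ hψ
    have h : ∀ᵐ x ∂μ, ∀ i : I,
        ((r • ψ i : Lp ℂ 2 μ) : X → ℂ) x = r • (ψ i : X → ℂ) x :=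
      ae_all_iff.2 fun i => Lp.coeFn_smul r (ψ i)
    change ∀ᵐ x ∂μ, ∃ y ∈ Y, ∀ i : I, ((r • ψ i : Lp ℂ 2 μ) : X → ℂ) x = y i
    filter_upwards [h, hψ] with x hx hy
    obtain ⟨y, hyY, hy⟩ := hy
    refine ⟨r • y, Y.smul_mem r hyY, fun i => ?_⟩
    have := hx i
    rw [hy i] at this
    exact this

end Valued

end FormMatrix

end

/-!
The semigroup exists because the operator of an elliptic form on a densely embedded Hilbert space
is densely defined, dissipative up to a shift, and has surjective resolvents by Lax–Milgram
(`range_formRelation`, `dissipative_formRelation`, `dense_fst_formRelation`). The theorem of Lumer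
and Phillips, proved here by Yosida approximation (`exists_isC0Semigroup_of_dissipative`), turns
this into a strongly continuous semigroup whose generator has exactly the graph of the operator.

For invariance, let `M` be a closed subspace of `H` such that every `u ∈ V` splits into a part in
`M` and a part in `Mᗮ`, both again in `V`. Then `M` is invariant if and only if `a(u, u') = 0` for
all `u ∈ V ∩ M` and `u' ∈ V ∩ Mᗮ`. If the form vanishes there, ellipticity bounds the growth of the
component in `Mᗮ` along an orbit, so an orbit that starts in `M` stays there
(`invariant_of_form_eq_zero`). Conversely, if `M` is invariant, then so it is under the resolvents,
and a Lax–Milgram argument in `V ∩ M` yields `a(u, u') = 0` (`form_eq_zero_of_invariant`).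

An orthonormal family `v` in `ℓ²(I)` and a Hilbert space `E` give the isometry
`(ψ_ℓ) ↦ ∑ v_ℓ ⊗ ψ_ℓ` from `ℓ²(L, E)` to `ℓ²(I, E)` (`synthesis`). For orthonormal bases of `Y` and
`Yᗮ`, the two ranges are orthogonal and span `ℓ²(I, E)` (`exists_eq_synthesis_add_synthesis`), and
synthesis commutes with the embedding of `V₀` into `L²`, so `V` splits as required. For `E = L²` the
first range is the space of functions with values in `Y` (`valuedIn_eq_range_synthesis`). Finally,
the multiple series always converges, to the value of the form at the two synthesized vectors
(`hasMatrixSum_synthesis`); its vanishing is thus the vanishing of `a` between `V ∩ M` and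
`V ∩ Mᗮ`.
-/

/-! ### Exponentials of bounded operators -/

section ExpBounds

variable {E : Type*} [NormedAddCommGroup E] [NormedSpace ℂ E] [CompleteSpace E]

theorem exp_add_of_commute_clm {A B : E →L[ℂ] E} (h : Commute A B) :
    NormedSpace.exp (A + B) = NormedSpace.exp A * NormedSpace.exp B := by
  let +nondep : NormedAlgebra ℚ (E →L[ℂ] E) := .restrictScalars ℚ ℂ _
  exact NormedSpace.exp_add_of_commute h

theorem hasDerivAt_exp_smul_apply (A : E →L[ℂ] E) (x : E) (t : ℝ) :
    HasDerivAt (fun s : ℝ => NormedSpace.exp (s • A) x) (NormedSpace.exp (t • A) (A x)) t :=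
  ((ContinuousLinearMap.apply ℂ E x).restrictScalars ℝ).hasFDerivAt.comp_hasDerivAt t
    (hasDerivAt_exp_smul_const A t)

theorem exp_smul_apply_comm {E : Type*} [NormedAddCommGroup E] [NormedSpace ℂ E] (A : E →L[ℂ] E)
    (x : E) (t : ℝ) :
    NormedSpace.exp (t • A) (A x) = A (NormedSpace.exp (t • A) x) :=
  DFunLike.congr_fun (((Commute.refl A).smul_left t).exp_left).eq x

/-- The semigroup generated by a bounded operator `N J - c` with `‖J‖ ≤ 1` grows at most like
`exp ((N - c) t)`. -/
theorem norm_exp_smul_le {J : E →L[ℂ] E} (hJ : ∀ x, ‖J x‖ ≤ ‖x‖) {N c : ℝ} (hN : 0 ≤ N)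
    {A : E →L[ℂ] E} (hA : ∀ x, A x = N • J x - c • x) {t : ℝ} (ht : 0 ≤ t) (x : E) :
    ‖NormedSpace.exp (t • A) x‖ ≤ Real.exp ((N - c) * t) * ‖x‖ := by
  -- `exp (c s) exp (s A) x` solves `f' = N J f`, to which Gronwall's inequality applies
  have hd : ∀ s : ℝ, HasDerivAt (fun s : ℝ => Real.exp (c * s) • NormedSpace.exp (s • A) x)
      (N • J (Real.exp (c * s) • NormedSpace.exp (s • A) x)) s := by
    intro s
    have h1 : HasDerivAt (fun s : ℝ => Real.exp (c * s)) (Real.exp (c * s) * c) s := by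
      simpa using ((hasDerivAt_id s).const_mul c).exp
    refine (h1.smul (hasDerivAt_exp_smul_apply A x s)).congr_deriv ?_
    rw [exp_smul_apply_comm, hA, ContinuousLinearMap.map_smul_of_tower]
    module
  have h := norm_le_gronwallBound_of_norm_deriv_right_le (K := N) (ε := 0) (a := 0) (b := t)
    (fun s _ => (hd s).continuousAt.continuousWithinAt) (fun s _ => (hd s).hasDerivWithinAt)
    le_rfl (fun s _ => by
      rw [norm_smul, Real.norm_of_nonneg hN, add_zero]
      exact mul_le_mul_of_nonneg_left (hJ _) hN) t ⟨ht, le_rfl⟩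
  rw [gronwallBound_ε0, norm_smul, Real.norm_of_nonneg (Real.exp_pos _).le] at h
  simp only [zero_smul, NormedSpace.exp_zero, mul_zero, Real.exp_zero, one_smul, sub_zero,
    one_apply_eq_self] at h
  have e : Real.exp ((N - c) * t) = Real.exp (N * t) / Real.exp (c * t) := by
    rw [← Real.exp_sub]; ring_nf
  rw [e, div_mul_eq_mul_div, le_div_iff₀ (Real.exp_pos _)]
  linarith

/-- Two commuting bounded operators generate semigroups whose distance on a vector is controlled by
the distance of the operators on that vector. -/
theorem norm_exp_smul_sub_exp_smul_le {A B : E →L[ℂ] E} (hAB : Commute A B) {ω : ℝ}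
    (hA : ∀ t : ℝ, 0 ≤ t → ∀ x, ‖NormedSpace.exp (t • A) x‖ ≤ Real.exp (ω * t) * ‖x‖)
    (hB : ∀ t : ℝ, 0 ≤ t → ∀ x, ‖NormedSpace.exp (t • B) x‖ ≤ Real.exp (ω * t) * ‖x‖)
    {t : ℝ} (ht : 0 ≤ t) (x : E) :
    ‖NormedSpace.exp (t • A) x - NormedSpace.exp (t • B) x‖ ≤
      Real.exp (ω * t) * ‖A x - B x‖ * t := by
  -- interpolate by `s ↦ exp (s A) exp ((t - s) B) = exp (s (A - B) + t B)`
  have key : ∀ s : ℝ, NormedSpace.exp (s • (A - B) + t • B) =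
      NormedSpace.exp (s • A) * NormedSpace.exp ((t - s) • B) := by
    intro s
    rw [← exp_add_of_commute_clm ((hAB.smul_left s).smul_right (t - s))]
    congr 1
    module
  have hc : Commute (A - B) B := hAB.sub_left (Commute.refl B)
  have hd : ∀ s : ℝ, HasDerivAt (fun s : ℝ => NormedSpace.exp (s • (A - B) + t • B) x)
      (NormedSpace.exp (s • (A - B) + t • B) (A x - B x)) s := by
    intro s
    have h2 : ∀ s : ℝ, ∀ z, NormedSpace.exp (s • (A - B) + t • B) z =
        NormedSpace.exp (s • (A - B)) (NormedSpace.exp (t • B) z) := fun s z => by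
      rw [exp_add_of_commute_clm ((hc.smul_left s).smul_right t)]; rfl
    simp only [h2]
    have h3 : NormedSpace.exp (t • B) (A x - B x) = (A - B) (NormedSpace.exp (t • B) x) :=
      (DFunLike.congr_fun ((hc.smul_right t).exp_right).eq x).symm
    rw [h3]
    exact hasDerivAt_exp_smul_apply (A - B) _ s
  have h := norm_image_sub_le_of_norm_deriv_le_segment' (a := 0) (b := t)
    (C := Real.exp (ω * t) * ‖A x - B x‖)
    (fun s _ => (hd s).hasDerivWithinAt) (fun s hs => by
      rw [key]
      refine (hA s hs.1 _).trans ?_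
      refine (mul_le_mul_of_nonneg_left (hB (t - s) (by linarith [hs.2]) _)
        (Real.exp_pos _).le).trans_eq ?_
      rw [← mul_assoc, ← Real.exp_add]
      ring_nf) t ⟨ht, le_rfl⟩
  simpa [key] using h

end ExpBounds

/-! ### Limits of semigroups with bounded generators -/

section TrotterKato

/-- Uniformly bounded operators that converge pointwise on a dense set are pointwise Cauchy. -/
theorem cauchySeq_apply_of_dense {E : Type*} [NormedAddCommGroup E] [NormedSpace ℂ E]
    {M : ℝ} {T : ℕ → E →L[ℂ] E} (hT : ∀ n x, ‖T n x‖ ≤ M * ‖x‖)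
    {D : Set E} (hD : Dense D) (h : ∀ x ∈ D, CauchySeq fun n => T n x) (x : E) :
    CauchySeq fun n => T n x := by
  have hM : 0 ≤ |M| := abs_nonneg M
  rw [Metric.cauchySeq_iff]
  intro ε hε
  obtain ⟨d, hd, hxd⟩ := hD.exists_dist_lt x (ε := ε / (3 * (|M| + 1))) (by positivity)
  obtain ⟨N, hN⟩ := Metric.cauchySeq_iff.1 (h d hd) (ε / 3) (by positivity)
  have hb : ∀ n, ‖T n (x - d)‖ ≤ ε / 3 := by
    intro n
    rw [dist_eq_norm] at hxd
    calc ‖T n (x - d)‖ ≤ M * ‖x - d‖ := hT n _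
      _ ≤ (|M| + 1) * (ε / (3 * (|M| + 1))) := by
        gcongr
        linarith [le_abs_self M]
      _ = ε / 3 := by field_simp
  refine ⟨N, fun m hm n hn => ?_⟩
  have := hN m hm n hn
  rw [dist_eq_norm] at this ⊢
  have e : T m x - T n x = T m (x - d) + (T m d - T n d) - T n (x - d) := by
    simp only [map_sub]; abel
  rw [e]
  have h1 := norm_sub_le (T m (x - d) + (T m d - T n d)) (T n (x - d))
  have h2 := norm_add_le (T m (x - d)) (T m d - T n d)
  linarith [hb m, hb n]


variable {H : Type*} [NormedAddCommGroup H] [InnerProductSpace ℂ H] [CompleteSpace H]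

/-- Convergence of semigroups from convergence of generators: commuting bounded operators `A n`
that converge on a dense set, with uniformly bounded exponentials, define a semigroup in the limit,
and its generator extends the limit of the `A n`. -/
theorem exists_isC0Semigroup_of_tendsto {A : ℕ → H →L[ℂ] H} (hcomm : ∀ m n, Commute (A m) (A n))
    {ω : ℝ} (hω : 0 ≤ ω)
    (hA : ∀ n, ∀ t : ℝ, 0 ≤ t → ∀ x, ‖NormedSpace.exp (t • A n) x‖ ≤ Real.exp (ω * t) * ‖x‖)
    {G : Set (H × H)} (hG : Dense (Prod.fst '' G))
    (hlim : ∀ p ∈ G, Tendsto (fun n => A n p.1) atTop (𝓝 p.2)) :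
    ∃ S : ℝ≥0 → H →L[ℂ] H, FormMatrix.IsC0Semigroup S ∧
      (∀ (t : ℝ≥0) x, ‖S t x‖ ≤ Real.exp (ω * t) * ‖x‖) ∧ G ⊆ FormMatrix.generatorGraph S := by
  have hcau : ∀ (t : ℝ≥0) (x : H), CauchySeq fun n => NormedSpace.exp ((t : ℝ) • A n) x := by
    intro t
    refine cauchySeq_apply_of_dense (fun n x => hA n t t.coe_nonneg x) hG ?_
    rintro _ ⟨p, hp, rfl⟩
    have hc := Metric.cauchySeq_iff.1 (hlim p hp).cauchySeq
    rw [Metric.cauchySeq_iff]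
    intro ε hε
    obtain ⟨N, hN⟩ := hc (ε / (Real.exp (ω * t) * (t + 1))) (by positivity)
    refine ⟨N, fun m hm n hn => ?_⟩
    have h1 := hN m hm n hn
    rw [dist_eq_norm] at h1 ⊢
    refine (norm_exp_smul_sub_exp_smul_le (hcomm m n) (hA m) (hA n) t.coe_nonneg p.1).trans_lt ?_
    rw [lt_div_iff₀ (by positivity)] at h1
    refine lt_of_le_of_lt ?_ h1
    nlinarith [mul_nonneg (Real.exp_pos (ω * t)).le (norm_nonneg (A m p.1 - A n p.1))]
  choose f hf using fun t x => cauchySeq_tendsto_of_complete (hcau t x)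
  let S : ℝ≥0 → H →L[ℂ] H := fun t =>
    continuousLinearMapOfTendsto (fun n => NormedSpace.exp ((t : ℝ) • A n)) (f := f t)
      (tendsto_pi_nhds.2 (hf t))
  have hS : ∀ (t : ℝ≥0) x,
      Tendsto (fun n => NormedSpace.exp ((t : ℝ) • A n) x) atTop (𝓝 (S t x)) := hf
  have hbound : ∀ (t : ℝ≥0) x, ‖S t x‖ ≤ Real.exp (ω * t) * ‖x‖ := fun t x =>
    le_of_tendsto (hS t x).norm (Eventually.of_forall fun n => hA n t t.coe_nonneg x)
  -- equicontinuity at time zero, uniformly in the approximation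
  have hequi : ∀ x, ∀ ε > 0, ∃ δ > 0, δ ≤ 1 ∧ ∀ n, ∀ s : ℝ, 0 ≤ s → s ≤ δ →
      ‖NormedSpace.exp (s • A n) x - x‖ ≤ ε := by
    intro x ε hε
    set M := Real.exp ω with hM
    have hM1 : 1 ≤ M := Real.one_le_exp hω
    obtain ⟨_, ⟨p, hp, rfl⟩, hd⟩ := hG.exists_dist_lt x (ε := ε / (2 * (M + 1))) (by positivity)
    rw [dist_eq_norm, lt_div_iff₀ (by positivity)] at hd
    obtain ⟨C, hC⟩ := (hlim p hp).norm.bddAbove_range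
    have hC' : ∀ n, ‖A n p.1‖ ≤ |C| + 1 := fun n =>
      (hC ⟨n, rfl⟩).trans (by linarith [le_abs_self C])
    have hCp : 0 < |C| + 1 := by positivity
    refine ⟨min 1 (ε / (2 * (M * (|C| + 1)))), by positivity, min_le_left _ _, ?_⟩
    intro n s hs hsδ
    have hs1 : s ≤ 1 := hsδ.trans (min_le_left _ _)
    have hs2 := hsδ.trans (min_le_right _ _)
    rw [le_div_iff₀ (by positivity)] at hs2
    have hexp : Real.exp (ω * s) ≤ M := Real.exp_le_exp.2 (by nlinarith)
    have h0 : ∀ t : ℝ, 0 ≤ t → ∀ x : H, ‖NormedSpace.exp (t • (0 : H →L[ℂ] H)) x‖ ≤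
        Real.exp (ω * t) * ‖x‖ := by
      intro t ht x
      simp only [smul_zero, NormedSpace.exp_zero, one_apply_eq_self]
      exact le_mul_of_one_le_left (norm_nonneg _) (Real.one_le_exp (by positivity))
    have h1 := norm_exp_smul_sub_exp_smul_le (Commute.zero_right (A n)) (hA n) h0 hs p.1
    simp only [smul_zero, NormedSpace.exp_zero, one_apply_eq_self, zero_apply, sub_zero] at h1
    have h2 : Real.exp (ω * s) * ‖A n p.1‖ * s ≤ M * (|C| + 1) * s := by
      gcongr
      exact hC' n
    have h3 : ‖NormedSpace.exp (s • A n) (x - p.1)‖ ≤ M * ‖x - p.1‖ :=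
      (hA n s hs _).trans (by gcongr)
    have e : NormedSpace.exp (s • A n) x - x = NormedSpace.exp (s • A n) (x - p.1) +
        (NormedSpace.exp (s • A n) p.1 - p.1) - (x - p.1) := by
      rw [map_sub]; abel
    rw [e]
    have h4 := norm_sub_le (NormedSpace.exp (s • A n) (x - p.1) +
        (NormedSpace.exp (s • A n) p.1 - p.1)) (x - p.1)
    have h5 := norm_add_le (NormedSpace.exp (s • A n) (x - p.1))
        (NormedSpace.exp (s • A n) p.1 - p.1)
    nlinarith
  have hadd : ∀ s t : ℝ≥0, S (s + t) = (S s).comp (S t) := by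
    intro s t
    ext x
    refine tendsto_nhds_unique (hS (s + t) x) ?_
    have e : ∀ n, NormedSpace.exp (((s + t : ℝ≥0) : ℝ) • A n) x =
        NormedSpace.exp ((s : ℝ) • A n) (S t x) +
          NormedSpace.exp ((s : ℝ) • A n) (NormedSpace.exp ((t : ℝ) • A n) x - S t x) := by
      intro n
      rw [NNReal.coe_add, add_smul, exp_add_of_commute_clm
        (((Commute.refl (A n)).smul_left _).smul_right _), map_sub]
      simp
    simp only [e]
    rw [← add_zero ((S s).comp (S t) x)]
    refine (hS s (S t x)).add (squeeze_zero_norm (fun n => hA n s s.coe_nonneg _) ?_)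
    have := ((hS t x).sub_const (S t x)).norm.const_mul (Real.exp (ω * s))
    simpa using this
  have hzero : S 0 = ContinuousLinearMap.id ℂ H := by
    ext x
    refine tendsto_nhds_unique (hS 0 x) ?_
    simp
  have hsmall : ∀ x, ∀ ε > 0, ∃ δ > 0, ∀ s : ℝ≥0, (s : ℝ) ≤ δ → ‖S s x - x‖ ≤ ε := by
    intro x ε hε
    obtain ⟨δ, hδ, -, h⟩ := hequi x ε hε
    exact ⟨δ, hδ, fun s hs => le_of_tendsto ((hS s x).sub_const x).norm
      (Eventually.of_forall fun n => h n s s.coe_nonneg hs)⟩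
  refine ⟨S, ⟨hzero, hadd, fun x => ?_⟩, hbound, ?_⟩
  · rw [Metric.continuous_iff]
    intro t ε hε
    obtain ⟨δ, hδ, h⟩ := hsmall x (ε / (2 * Real.exp (ω * (t + 1)))) (by positivity)
    -- two times `r ≤ r + h ≤ t + 1` give orbit points at distance at most `e ^ (ω (t + 1))` times
    -- the displacement in time `h`
    have hstep : ∀ r h : ℝ≥0, r ≤ t + 1 → (h : ℝ) ≤ δ → ‖S (r + h) x - S r x‖ < ε := by
      intro r d hr hd
      rw [hadd, ContinuousLinearMap.comp_apply, ← map_sub]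
      refine (hbound r _).trans_lt ?_
      have h1 := h d hd
      rw [le_div_iff₀ (by positivity)] at h1
      have h2 : Real.exp (ω * r) ≤ Real.exp (ω * (t + 1)) := by
        have : (r : ℝ) ≤ t + 1 := by exact_mod_cast hr
        gcongr
      nlinarith [mul_le_mul_of_nonneg_right h2 (norm_nonneg (S d x - x))]
    refine ⟨min δ 1, by positivity, fun s hs => ?_⟩
    rw [NNReal.dist_eq, lt_min_iff] at hs
    rw [dist_eq_norm]
    rcases le_total s t with hst | hst
    · obtain ⟨d, rfl⟩ := exists_add_of_le hst
      rw [norm_sub_rev]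
      refine hstep s d ?_ ?_
      · exact (le_add_of_nonneg_right d.2).trans (le_add_of_nonneg_right zero_le_one)
      · have := hs.1
        rw [NNReal.coe_add, abs_sub_comm, add_sub_cancel_left, abs_of_nonneg d.coe_nonneg] at this
        exact this.le
    · obtain ⟨d, rfl⟩ := exists_add_of_le hst
      refine hstep t d (le_add_of_nonneg_right zero_le_one) ?_
      have := hs.1
      rw [NNReal.coe_add, add_sub_cancel_left, abs_of_nonneg d.coe_nonneg] at this
      exact this.le
  · intro p hp
    change Tendsto (fun t : ℝ≥0 => ((t : ℝ) : ℂ)⁻¹ • (S t p.1 - p.1)) (𝓝[>] 0) (𝓝 p.2)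
    rw [Metric.tendsto_nhdsWithin_nhds]
    intro ε hε
    obtain ⟨δ, hδ, hδ1, h⟩ := hequi p.2 (ε / 2) (by positivity)
    refine ⟨δ, hδ, fun t ht htδ => ?_⟩
    have ht0 : (0 : ℝ) < t := ht
    rw [NNReal.dist_eq, NNReal.coe_zero, sub_zero, abs_of_pos ht0] at htδ
    have key : ∀ n, ‖NormedSpace.exp ((t : ℝ) • A n) p.1 - p.1 - (t : ℝ) • A n p.1‖ ≤
        (ε / 2 + (Real.exp ω + 1) * ‖A n p.1 - p.2‖) * t := by
      intro n
      have hd : ∀ s : ℝ, HasDerivAt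
          (fun s : ℝ => NormedSpace.exp (s • A n) p.1 - s • A n p.1)
          (NormedSpace.exp (s • A n) (A n p.1) - A n p.1) s := fun s => by
        refine ((hasDerivAt_exp_smul_apply (A n) p.1 s).sub
          ((hasDerivAt_id s).smul_const (A n p.1))).congr_deriv ?_
        rw [one_smul]
      have := norm_image_sub_le_of_norm_deriv_le_segment' (a := 0) (b := t)
        (C := ε / 2 + (Real.exp ω + 1) * ‖A n p.1 - p.2‖)
        (fun s _ => (hd s).hasDerivWithinAt) (fun s hs => by
          have e : NormedSpace.exp (s • A n) (A n p.1) - A n p.1 =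
              (NormedSpace.exp (s • A n) p.2 - p.2) +
              (NormedSpace.exp (s • A n) (A n p.1 - p.2) - (A n p.1 - p.2)) := by
            rw [map_sub]; abel
          rw [e]
          refine (norm_add_le _ _).trans (add_le_add (h n s hs.1 (hs.2.le.trans htδ.le)) ?_)
          refine (norm_sub_le _ _).trans ?_
          have h1 := hA n s hs.1 (A n p.1 - p.2)
          have h2 : Real.exp (ω * s) ≤ Real.exp ω :=
            Real.exp_le_exp.2 (by nlinarith [hs.2, hs.1])
          nlinarith [mul_le_mul_of_nonneg_right h2 (norm_nonneg (A n p.1 - p.2))])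
        (t : ℝ) ⟨ht0.le, le_rfl⟩
      simp only [zero_smul, NormedSpace.exp_zero, one_apply_eq_self, sub_zero] at this
      convert this using 2
      abel
    have h1 : ‖S t p.1 - p.1 - (t : ℝ) • p.2‖ ≤ ε / 2 * t := by
      refine le_of_tendsto_of_tendsto
        (((hS t p.1).sub_const p.1).sub ((hlim p hp).const_smul (t : ℝ))).norm ?_
        (Eventually.of_forall key)
      have := ((((hlim p hp).sub_const p.2).norm.const_mul (Real.exp ω + 1)).const_add
        (ε / 2)).mul_const (t : ℝ)
      simpa using this
    have e : ((t : ℝ) : ℂ)⁻¹ • (S t p.1 - p.1) - p.2 =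
        ((t : ℝ) : ℂ)⁻¹ • (S t p.1 - p.1 - (t : ℝ) • p.2) := by
      have : ((t : ℝ) : ℂ) ≠ 0 := by exact_mod_cast ht0.ne'
      rw [smul_sub (((t : ℝ) : ℂ)⁻¹) (S t p.1 - p.1), ← Complex.coe_smul, smul_smul,
        inv_mul_cancel₀ this, one_smul]
    rw [dist_eq_norm, e, norm_smul, norm_inv, Complex.norm_real, Real.norm_of_nonneg ht0.le,
      inv_mul_lt_iff₀ ht0]
    nlinarith

end TrotterKato

/-! ### Orbits and generators of strongly continuous semigroups -/

section Generator

variable {H : Type*} [NormedAddCommGroup H] [InnerProductSpace ℂ H]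

theorem sub_mem_generatorGraph {S : ℝ≥0 → H →L[ℂ] H} {p q : H × H}
    (hp : p ∈ FormMatrix.generatorGraph S) (hq : q ∈ FormMatrix.generatorGraph S) :
    p - q ∈ FormMatrix.generatorGraph S := by
  refine (Tendsto.sub hp hq).congr fun t => ?_
  rw [← smul_sub, Prod.fst_sub, map_sub]
  congr 1
  abel

theorem tendsto_coe_nnreal_nhdsGT_zero :
    Tendsto (fun t : ℝ≥0 => (t : ℝ)) (𝓝[>] 0) (𝓝[>] 0) :=
  tendsto_nhdsWithin_iff.2 ⟨(NNReal.continuous_coe.tendsto' 0 0 rfl).mono_left nhdsWithin_le_nhds,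
    eventually_nhdsWithin_of_forall fun _ ht => NNReal.coe_pos.2 ht⟩

/-- The growth bound `exp (ω t)` makes the generator dissipative up to the shift `ω`. -/
theorem re_inner_le_of_mem_generatorGraph {S : ℝ≥0 → H →L[ℂ] H} {ω : ℝ}
    (hS : ∀ (t : ℝ≥0) x, ‖S t x‖ ≤ Real.exp (ω * t) * ‖x‖) {p : H × H}
    (hp : p ∈ FormMatrix.generatorGraph S) :
    (inner ℂ p.1 p.2).re ≤ ω * ‖p.1‖ ^ 2 := by
  have h1 : Tendsto (fun t : ℝ≥0 => (inner ℂ p.1 (((t : ℝ) : ℂ)⁻¹ • (S t p.1 - p.1))).re)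
      (𝓝[>] 0) (𝓝 (inner ℂ p.1 p.2).re) :=
    (Complex.continuous_re.tendsto _).comp (Tendsto.inner tendsto_const_nhds hp)
  have h2 : Tendsto (fun t : ℝ≥0 => (t : ℝ)⁻¹ * (Real.exp (ω * t) - 1) * ‖p.1‖ ^ 2)
      (𝓝[>] 0) (𝓝 (ω * ‖p.1‖ ^ 2)) := by
    have hd : HasDerivAt (fun t : ℝ => Real.exp (ω * t)) ω 0 := by
      simpa using ((hasDerivAt_id (0 : ℝ)).const_mul ω).exp
    have := (hasDerivAt_iff_tendsto_slope_zero.1 hd).comp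
      (tendsto_coe_nnreal_nhdsGT_zero.mono_right (nhdsGT_le_nhdsNE 0))
    refine Tendsto.mul_const _ (this.congr fun t => ?_)
    simp
  refine le_of_tendsto_of_tendsto h1 h2 (Eventually.of_forall fun t => ?_)
  have ht : (0 : ℝ) ≤ (t : ℝ)⁻¹ := inv_nonneg.2 t.coe_nonneg
  change (inner ℂ p.1 (((t : ℝ) : ℂ)⁻¹ • (S t p.1 - p.1))).re ≤ _
  rw [inner_smul_right, ← Complex.ofReal_inv, Complex.re_ofReal_mul]
  simp only [mul_assoc]
  refine mul_le_mul_of_nonneg_left ?_ ht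
  rw [inner_sub_right, Complex.sub_re, inner_self_eq_norm_sq_to_K]
  have h3 : (inner ℂ p.1 (S t p.1)).re ≤ ‖p.1‖ * ‖S t p.1‖ := re_inner_le_norm (𝕜 := ℂ) _ _
  have h4 := mul_le_mul_of_nonneg_left (hS t p.1) (norm_nonneg p.1)
  have h5 : (((‖p.1‖ : ℝ) : ℂ) ^ 2).re = ‖p.1‖ ^ 2 := by
    rw [← Complex.ofReal_pow, Complex.ofReal_re]
  change _ - (((‖p.1‖ : ℝ) : ℂ) ^ 2).re ≤ _
  rw [h5]
  nlinarith

theorem apply_mem_generatorGraph {S : ℝ≥0 → H →L[ℂ] H} (hS : FormMatrix.IsC0Semigroup S)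
    {p : H × H} (hp : p ∈ FormMatrix.generatorGraph S) (t : ℝ≥0) :
    (S t p.1, S t p.2) ∈ FormMatrix.generatorGraph S := by
  refine (((S t).continuous.tendsto _).comp hp).congr fun s => ?_
  have h : S s (S t p.1) = S t (S s p.1) := by
    rw [← ContinuousLinearMap.comp_apply, ← hS.map_add, add_comm, hS.map_add]; rfl
  simp only [Function.comp_apply, map_smul, map_sub, h]

theorem continuous_orbit {S : ℝ≥0 → H →L[ℂ] H} (hS : FormMatrix.IsC0Semigroup S) (x : H) :
    Continuous fun s : ℝ => S s.toNNReal x :=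
  (hS.strongly_continuous x).comp continuous_real_toNNReal

theorem hasDerivWithinAt_orbit {S : ℝ≥0 → H →L[ℂ] H} (hS : FormMatrix.IsC0Semigroup S)
    {p : H × H} (hp : p ∈ FormMatrix.generatorGraph S) {r : ℝ} (hr : 0 ≤ r) :
    HasDerivWithinAt (fun s : ℝ => S s.toNNReal p.1) (S r.toNNReal p.2) (Set.Ici r) r := by
  rw [hasDerivWithinAt_iff_tendsto_slope, Set.Ici_sdiff_left]
  have h1 : Tendsto (fun s : ℝ => (s - r).toNNReal) (𝓝[>] r) (𝓝[>] 0) := by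
    refine tendsto_nhdsWithin_iff.2 ⟨?_, eventually_nhdsWithin_of_forall fun s hs => ?_⟩
    · exact ((continuous_real_toNNReal.comp (continuous_id.sub continuous_const)).tendsto' r 0
        (by simp)).mono_left nhdsWithin_le_nhds
    · exact Real.toNNReal_pos.2 (sub_pos.2 hs)
  refine Tendsto.congr' ?_ ((apply_mem_generatorGraph hS hp r.toNNReal).comp h1)
  filter_upwards [self_mem_nhdsWithin] with s hs
  have hs' : 0 ≤ s - r := (sub_pos.2 hs).le
  have e : s.toNNReal = (s - r).toNNReal + r.toNNReal := by
    rw [← Real.toNNReal_add hs' hr, sub_add_cancel]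
  simp only [Function.comp_apply, slope_def_module]
  rw [e, hS.map_add, ContinuousLinearMap.comp_apply, Real.coe_toNNReal _ hs',
    ← Complex.ofReal_inv, Complex.coe_smul]

/-- Growth of `Q` along an orbit is controlled by a dissipativity estimate for the generator seen
through `Q`. -/
theorem norm_orbit_le_of_dissipative {S : ℝ≥0 → H →L[ℂ] H} (hS : FormMatrix.IsC0Semigroup S)
    (Q : H →L[ℂ] H) {ω : ℝ}
    (hQ : ∀ p ∈ FormMatrix.generatorGraph S, (inner ℂ (Q p.1) (Q p.2)).re ≤ ω * ‖Q p.1‖ ^ 2)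
    {p : H × H} (hp : p ∈ FormMatrix.generatorGraph S) (t : ℝ≥0) :
    ‖Q (S t p.1)‖ ≤ Real.exp (ω * t) * ‖Q p.1‖ := by
  have hd : ∀ r : ℝ, 0 ≤ r → HasDerivWithinAt (fun s : ℝ => ‖Q (S s.toNNReal p.1)‖ ^ 2)
      (2 * (inner ℂ (Q (S r.toNNReal p.1)) (Q (S r.toNNReal p.2))).re) (Set.Ici r) r := by
    intro r hr
    have h : HasDerivWithinAt (fun s : ℝ => Q (S s.toNNReal p.1)) (Q (S r.toNNReal p.2))
        (Set.Ici r) r :=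
      (Q.restrictScalars ℝ).hasFDerivAt.comp_hasDerivWithinAt r (hasDerivWithinAt_orbit hS hp hr)
    let : InnerProductSpace ℝ H := InnerProductSpace.complexToReal
    exact h.norm_sq
  have h := le_gronwallBound_of_liminf_deriv_right_le (K := 2 * ω) (ε := 0) (a := 0) (b := t)
    (f := fun s : ℝ => ‖Q (S s.toNNReal p.1)‖ ^ 2)
    ((Q.continuous.comp (continuous_orbit hS p.1)).norm.pow 2).continuousOn
    (fun r hr _ h => (hd r hr.1).liminf_right_slope_le h) le_rfl
    (fun r hr => by
      have := hQ _ (apply_mem_generatorGraph hS hp r.toNNReal)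
      simp only at this
      linarith) t ⟨t.coe_nonneg, le_rfl⟩
  simp only [Real.toNNReal_coe, Real.toNNReal_zero, hS.map_zero, ContinuousLinearMap.id_apply,
    sub_zero, gronwallBound_ε0] at h
  refine (sq_le_sq₀ (norm_nonneg _) (by positivity)).1 ?_
  refine h.trans_eq ?_
  rw [mul_pow, ← Real.exp_nat_mul]
  push_cast
  ring_nf

/-- Let `(x, A x) = p` be in the graph of the generator and let `c` exceed the growth rate of the
orbit of `x`. If the orbit of `c x - A x` is orthogonal to `q`, then so is `x`. This replaces the
representation of the resolvent as a Laplace transform. -/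
theorem inner_eq_zero_of_orbit {S : ℝ≥0 → H →L[ℂ] H} (hS : FormMatrix.IsC0Semigroup S)
    {p : H × H} (hp : p ∈ FormMatrix.generatorGraph S) {ω c : ℝ} (hc : ω < c)
    (hgrow : ∀ t : ℝ≥0, ‖S t p.1‖ ≤ Real.exp (ω * t) * ‖p.1‖) {q : H}
    (hq : ∀ t : ℝ≥0, inner ℂ q (S t (c • p.1 - p.2)) = 0) : inner ℂ q p.1 = 0 := by
  -- `s ↦ exp (-c s) ⟨q, S s x⟩` is constant, and it tends to zero at infinity
  set f : ℝ → ℂ := fun s => Real.exp (-c * s) • inner ℂ q (S s.toNNReal p.1) with hf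
  have hd : ∀ r : ℝ, 0 ≤ r → HasDerivWithinAt f 0 (Set.Ici r) r := by
    intro r hr
    have h1 : HasDerivAt (fun s : ℝ => Real.exp (-c * s)) (Real.exp (-c * r) * -c) r := by
      simpa using ((hasDerivAt_id r).const_mul (-c)).exp
    have h2 : HasDerivWithinAt (fun s : ℝ => inner ℂ q (S s.toNNReal p.1))
        (inner ℂ q (S r.toNNReal p.2)) (Set.Ici r) r :=
      ((innerSL ℂ q).restrictScalars ℝ).hasFDerivAt.comp_hasDerivWithinAt r
        (hasDerivWithinAt_orbit hS hp hr)
    refine (h1.hasDerivWithinAt.smul h2).congr_deriv ?_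
    have h3 := hq r.toNNReal
    rw [map_sub, inner_sub_right, ContinuousLinearMap.map_smul_of_tower, ← Complex.coe_smul,
      inner_smul_right, sub_eq_zero] at h3
    rw [← h3]
    simp only [Complex.real_smul]
    push_cast
    ring
  have hcont : Continuous f := by
    have h1 : Continuous fun s : ℝ => Real.exp (-c * s) := by fun_prop
    refine h1.smul ?_
    exact Continuous.inner continuous_const (continuous_orbit hS p.1)
  have hconst : ∀ t : ℝ, 0 ≤ t → f t = inner ℂ q p.1 := by
    intro t ht
    rw [constant_of_has_deriv_right_zero hcont.continuousOn (fun r hr => hd r hr.1) t ⟨ht, le_rfl⟩]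
    simp [hf, hS.map_zero]
  have hlim : Tendsto f atTop (𝓝 0) := by
    refine squeeze_zero_norm' (a := fun s : ℝ => (‖q‖ * ‖p.1‖) * Real.exp (-((c - ω) * s))) ?_ ?_
    · filter_upwards [eventually_ge_atTop 0] with s hs
      rw [hf, norm_smul, Real.norm_of_nonneg (Real.exp_pos _).le]
      have h1 : ‖inner ℂ q (S s.toNNReal p.1)‖ ≤ ‖q‖ * (Real.exp (ω * s) * ‖p.1‖) := by
        refine (norm_inner_le_norm _ _).trans (mul_le_mul_of_nonneg_left ?_ (norm_nonneg q))
        simpa [Real.coe_toNNReal _ hs] using hgrow s.toNNReal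
      refine (mul_le_mul_of_nonneg_left h1 (Real.exp_pos _).le).trans_eq ?_
      have : Real.exp (-((c - ω) * s)) = Real.exp (-c * s) * Real.exp (ω * s) := by
        rw [← Real.exp_add]; ring_nf
      rw [this]
      ring
    · have := (Real.tendsto_exp_neg_atTop_nhds_zero.comp
        (tendsto_id.const_mul_atTop (sub_pos.2 hc))).const_mul (‖q‖ * ‖p.1‖)
      simpa using this
  refine tendsto_nhds_unique (tendsto_const_nhds.congr' ?_) hlim
  filter_upwards [eventually_ge_atTop 0] with s hs
  exact (hconst s hs).symm

end Generator

/-! ### Generation of semigroups by dissipative operators -/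

section LumerPhillips

variable {H : Type*} [NormedAddCommGroup H] [InnerProductSpace ℂ H]

/-- Dissipativity bounds `c - A` from below. -/
theorem sub_mul_norm_le_of_dissipative {A : Submodule ℂ (H × H)} {ω : ℝ}
    (hdis : ∀ p ∈ A, (inner ℂ p.1 p.2).re ≤ ω * ‖p.1‖ ^ 2) (c : ℝ) {p : H × H} (hp : p ∈ A) :
    (c - ω) * ‖p.1‖ ≤ ‖c • p.1 - p.2‖ := by
  rcases eq_or_ne p.1 0 with h0 | h0
  · rw [h0, norm_zero, mul_zero]; exact norm_nonneg _
  have hpos : 0 < ‖p.1‖ := norm_pos_iff.2 h0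
  have h1 : (inner ℂ p.1 (c • p.1 - p.2)).re ≤ ‖p.1‖ * ‖c • p.1 - p.2‖ :=
    re_inner_le_norm (𝕜 := ℂ) _ _
  have h2 : (inner ℂ p.1 (c • p.1 - p.2)).re = c * ‖p.1‖ ^ 2 - (inner ℂ p.1 p.2).re := by
    rw [inner_sub_right, ← Complex.coe_smul, inner_smul_right, inner_self_eq_norm_sq_to_K,
      Complex.sub_re, Complex.re_ofReal_mul]
    congr 2
    change (((‖p.1‖ : ℝ) : ℂ) ^ 2).re = _
    rw [← Complex.ofReal_pow, Complex.ofReal_re]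
  have h3 := hdis p hp
  refine le_of_mul_le_mul_left ?_ hpos
  nlinarith

/-- A dissipative operator for which `c - A` is onto has a bounded resolvent at `c`. -/
theorem exists_resolvent {A : Submodule ℂ (H × H)} {ω : ℝ}
    (hdis : ∀ p ∈ A, (inner ℂ p.1 p.2).re ≤ ω * ‖p.1‖ ^ 2) {c : ℝ} (hc : ω < c)
    (hrange : ∀ f : H, ∃ p ∈ A, c • p.1 - p.2 = f) :
    ∃ R : H →L[ℂ] H, (∀ p ∈ A, R (c • p.1 - p.2) = p.1) ∧ (∀ f, (R f, c • R f - f) ∈ A) ∧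
      ∀ f, (c - ω) * ‖R f‖ ≤ ‖f‖ := by
  have hpos : 0 < c - ω := sub_pos.2 hc
  have hzero : ∀ p ∈ A, c • p.1 - p.2 = 0 → p.1 = 0 := by
    intro p hp h
    have := sub_mul_norm_le_of_dissipative hdis c hp
    rw [h, norm_zero] at this
    exact norm_le_zero_iff.1 (by nlinarith [norm_nonneg p.1])
  choose g hgA hg using hrange
  have huniq : ∀ p ∈ A, ∀ q ∈ A, c • p.1 - p.2 = c • q.1 - q.2 → p.1 = q.1 := by
    intro p hp q hq h
    refine sub_eq_zero.1 (hzero (p - q) (A.sub_mem hp hq) ?_)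
    rw [Prod.fst_sub, Prod.snd_sub, smul_sub, ← sub_eq_zero.2 h]
    abel
  let R₀ : H →ₗ[ℂ] H :=
    { toFun := fun f => (g f).1
      map_add' := fun f f' => by
        refine huniq _ (hgA _) _ (A.add_mem (hgA f) (hgA f')) ?_
        rw [hg, Prod.fst_add, Prod.snd_add]
        conv_lhs => rw [← hg f, ← hg f']
        rw [smul_add]; abel
      map_smul' := fun z f => by
        refine huniq _ (hgA _) _ (A.smul_mem z (hgA f)) ?_
        rw [hg, Prod.smul_fst, Prod.smul_snd]
        conv_lhs => rw [← hg f]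
        rw [smul_sub, smul_comm] }
  have hR₀ : ∀ f, (c - ω) * ‖R₀ f‖ ≤ ‖f‖ := fun f => by
    have := sub_mul_norm_le_of_dissipative hdis c (hgA f)
    rwa [hg] at this
  refine ⟨R₀.mkContinuous (c - ω)⁻¹ fun f => ?_, fun p hp => ?_, fun f => ?_, hR₀⟩
  · rw [← div_eq_inv_mul, le_div_iff₀ hpos, mul_comm]
    exact hR₀ f
  · exact huniq _ (hgA _) p hp (hg _)
  · have : c • (g f).1 - f = (g f).2 := by
      nth_rewrite 2 [← hg f]
      abel
    change ((g f).1, c • (g f).1 - f) ∈ A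
    rw [this]
    exact hgA f

/-- The generation theorem of Lumer and Phillips in a Hilbert space, for an operator given by its
graph; the semigroup is the limit of those of the Yosida approximations. -/
theorem exists_isC0Semigroup_of_dissipative [CompleteSpace H] {A : Submodule ℂ (H × H)} {ω : ℝ}
    (hω : 0 ≤ ω) (hdense : Dense (Prod.fst '' (A : Set (H × H))))
    (hdis : ∀ p ∈ A, (inner ℂ p.1 p.2).re ≤ ω * ‖p.1‖ ^ 2)
    (hrange : ∀ c : ℝ, ω < c → ∀ f : H, ∃ p ∈ A, c • p.1 - p.2 = f) :
    ∃ S : ℝ≥0 → H →L[ℂ] H, FormMatrix.IsC0Semigroup S ∧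
      FormMatrix.generatorGraph S = (A : Set (H × H)) := by
  set N : ℕ → ℝ := fun n => n + 1 with hN
  have hNpos : ∀ n, 0 < N n := fun n => by positivity
  choose R hRA hRmem hRle using fun n =>
    exists_resolvent hdis (show ω < ω + N n by linarith [hNpos n])
      (hrange _ (by linarith [hNpos n]))
  simp only [add_sub_cancel_left] at hRle
  -- the contractions `J n = N n * (ω + N n - A)⁻¹` and the Yosida approximations of `A`
  let J : ℕ → H →L[ℂ] H := fun n => N n • R n
  let B : ℕ → H →L[ℂ] H := fun n => N n • J n - (N n - ω) • ContinuousLinearMap.id ℂ H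
  have hJ : ∀ n x, ‖J n x‖ ≤ ‖x‖ := fun n x => by
    change ‖N n • R n x‖ ≤ _
    rw [norm_smul, Real.norm_of_nonneg (hNpos n).le]
    exact hRle n x
  have hB : ∀ n x, B n x = N n • J n x - (N n - ω) • x := fun n x => rfl
  -- resolvents commute, by the resolvent identity `key`
  have hRR : ∀ m n, Commute (R m) (R n) := by
    have key : ∀ m n f, R m f + (N m - N n) • R m (R n f) = R n f := by
      intro m n f
      have := hRA m _ (hRmem n f)
      simp only at this
      rw [← ContinuousLinearMap.map_smul_of_tower, ← map_add]
      convert this using 2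
      module
    intro m n
    rcases eq_or_ne (N m) (N n) with h | h
    · have : m = n := by
        have h' : (m : ℝ) + 1 = n + 1 := h
        exact_mod_cast add_right_cancel h'
      rw [this]
    · ext f
      have h1 := key m n f
      have h2 := key n m f
      have h3 : (N m - N n) • (R m (R n f) - R n (R m f)) = 0 := by
        rw [← h1] at h2
        have h4 : (N n - N m) • R n (R m f) + (N m - N n) • R m (R n f) = 0 := by
          have h5 := sub_eq_zero.2 h2
          rw [← h5]
          rw [show R n f = R m f + (N m - N n) • R m (R n f) from h1.symm]
          abel
        rw [← h4]
        module
      rcases smul_eq_zero.1 h3 with h4 | h4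
      · exact absurd (sub_eq_zero.1 h4) h
      · exact sub_eq_zero.1 h4
  have hcomm : ∀ m n, Commute (B m) (B n) := by
    intro m n
    have h1 : Commute (N m • J m) (N n • J n) :=
      ((((hRR m n).smul_left _).smul_left _).smul_right _).smul_right _
    have h2 : ∀ (a : ℝ) (T : H →L[ℂ] H), Commute (a • ContinuousLinearMap.id ℂ H) T :=
      fun a T => (Commute.one_left T).smul_left a
    exact (h1.sub_right (h2 _ _).symm).sub_left ((h2 _ _).sub_right (h2 _ _))
  have hexp : ∀ n, ∀ t : ℝ, 0 ≤ t → ∀ x,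
      ‖NormedSpace.exp (t • B n) x‖ ≤ Real.exp (ω * t) * ‖x‖ := by
    intro n t ht x
    have := norm_exp_smul_le (hJ n) (hNpos n).le (hB n) ht x
    rwa [sub_sub_cancel] at this
  have hN_inv : Tendsto (fun n => (N n)⁻¹) atTop (𝓝 0) := by
    simpa [hN] using tendsto_one_div_add_atTop_nhds_zero_nat (𝕜 := ℝ)
  have hJA : ∀ n, ∀ p ∈ A, J n p.1 = p.1 + R n (p.2 - ω • p.1) := by
    intro n p hp
    change N n • R n p.1 = _
    conv_rhs => rw [← hRA n p hp]
    rw [← map_add, ← ContinuousLinearMap.map_smul_of_tower, hRA n p hp]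
    congr 1
    module
  have hJlim : ∀ x, Tendsto (fun n => J n x) atTop (𝓝 x) := by
    intro x
    rw [Metric.tendsto_atTop]
    intro ε hε
    obtain ⟨_, ⟨p, hp, rfl⟩, hd⟩ := hdense.exists_dist_lt x (ε := ε / 3) (by positivity)
    have h1 : Tendsto (fun n => (N n)⁻¹ * ‖p.2 - ω • p.1‖) atTop (𝓝 0) := by
      simpa using hN_inv.mul_const ‖p.2 - ω • p.1‖
    obtain ⟨k, hk⟩ := Filter.eventually_atTop.1
      (h1.eventually (gt_mem_nhds (show (0 : ℝ) < ε / 3 by positivity)))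
    refine ⟨k, fun n hn => ?_⟩
    have h2 : ‖J n p.1 - p.1‖ ≤ (N n)⁻¹ * ‖p.2 - ω • p.1‖ := by
      rw [hJA n p hp, add_sub_cancel_left, ← div_eq_inv_mul, le_div_iff₀ (hNpos n), mul_comm]
      exact hRle n _
    have h3 := hk n hn
    rw [dist_eq_norm] at hd ⊢
    have e : J n x - x = J n (x - p.1) + (J n p.1 - p.1) - (x - p.1) := by
      rw [map_sub]; abel
    rw [e]
    have h4 := norm_sub_le (J n (x - p.1) + (J n p.1 - p.1)) (x - p.1)
    have h5 := norm_add_le (J n (x - p.1)) (J n p.1 - p.1)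
    linarith [hJ n (x - p.1)]
  have hBlim : ∀ p ∈ (A : Set (H × H)), Tendsto (fun n => B n p.1) atTop (𝓝 p.2) := by
    intro p hp
    have h1 : ∀ n, B n p.1 = J n (p.2 - ω • p.1) + ω • p.1 := by
      intro n
      rw [hB, hJA n p hp]
      change _ = N n • R n _ + _
      module
    simp only [h1]
    convert (hJlim (p.2 - ω • p.1)).add_const (ω • p.1) using 2
    abel
  obtain ⟨S, hS, hgrow, hsub⟩ := exists_isC0Semigroup_of_tendsto hcomm hω hexp hdense hBlim
  refine ⟨S, hS, Set.Subset.antisymm (fun q hq => ?_) hsub⟩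
  -- `ω + 1 - A` is onto and `ω + 1` minus the generator is injective, so they coincide
  obtain ⟨p, hp, hpq⟩ := hrange (ω + 1) (by linarith) ((ω + 1) • q.1 - q.2)
  have hd := re_inner_le_of_mem_generatorGraph hgrow (sub_mem_generatorGraph hq (hsub hp))
  have e : (q - p).2 = (ω + 1) • (q - p).1 := by
    rw [Prod.fst_sub, Prod.snd_sub, smul_sub, ← sub_eq_zero]
    rw [← sub_eq_zero.2 hpq]
    abel
  rw [e, ← Complex.coe_smul, inner_smul_right, Complex.re_ofReal_mul,
    inner_self_eq_norm_sq_to_K] at hd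
  have h5 : (((‖(q - p).1‖ : ℝ) : ℂ) ^ 2).re = ‖(q - p).1‖ ^ 2 := by
    rw [← Complex.ofReal_pow, Complex.ofReal_re]
  change (ω + 1) * (((‖(q - p).1‖ : ℝ) : ℂ) ^ 2).re ≤ _ at hd
  rw [h5] at hd
  have h0 : (q - p).1 = 0 := by
    have : ‖(q - p).1‖ ^ 2 ≤ 0 := by linarith
    exact norm_eq_zero.1 (pow_eq_zero_iff two_ne_zero |>.1 (le_antisymm this (sq_nonneg _)))
  have hqp : q = p := by
    rw [h0, smul_zero] at e
    exact sub_eq_zero.1 (Prod.ext h0 e)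
  rw [hqp]
  exact hp

end LumerPhillips

/-! ### Semigroups of elliptic forms and invariant subspaces -/

section Form

variable {V H : Type*} [NormedAddCommGroup V] [InnerProductSpace ℂ V]
  [NormedAddCommGroup H] [InnerProductSpace ℂ H]

/-- A bounded operator with a coercive quadratic form is onto (Lax–Milgram). -/
theorem surjective_of_coercive [CompleteSpace V] {T : V →L[ℂ] V} {α : ℝ} (hα : 0 < α)
    (hT : ∀ v, α * ‖v‖ ^ 2 ≤ (inner ℂ (T v) v).re) : Function.Surjective T := by
  have hbelow : ∀ v, α * ‖v‖ ≤ ‖T v‖ := by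
    intro v
    rcases eq_or_ne v 0 with rfl | h0
    · simp
    have hpos : 0 < ‖v‖ := norm_pos_iff.2 h0
    have h1 : (inner ℂ (T v) v).re ≤ ‖T v‖ * ‖v‖ := re_inner_le_norm (𝕜 := ℂ) _ _
    refine le_of_mul_le_mul_right ?_ hpos
    nlinarith [hT v]
  have hanti : AntilipschitzWith (α⁻¹).toNNReal T := by
    refine ContinuousLinearMap.antilipschitz_of_bound T fun v => ?_
    rw [Real.coe_toNNReal _ (inv_pos.2 hα).le, ← div_eq_inv_mul, le_div_iff₀ hα, mul_comm]
    exact hbelow v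
  have hclosed : IsClosed (T.range : Set V) := hanti.isClosed_range T.uniformContinuous
  have := hclosed.completeSpace_coe
  refine LinearMap.range_eq_top.1 ?_
  rw [← T.range.orthogonal_orthogonal, Submodule.eq_top_iff']
  intro v w hw
  have h1 : inner ℂ (T w) w = 0 := hw _ ⟨w, rfl⟩
  have h2 := hT w
  rw [h1, Complex.zero_re] at h2
  have h3 : ‖w‖ ^ 2 ≤ 0 := by nlinarith [sq_nonneg ‖w‖]
  have h4 : w = 0 :=
    norm_eq_zero.1 ((pow_eq_zero_iff two_ne_zero).1 (le_antisymm h3 (sq_nonneg _)))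
  rw [h4, inner_zero_left]

/-- The form `a + c (j · | j ·)` is represented by a bounded operator in the inner product of `V`.
The operator acts on the antilinear argument `w` of the form. -/
theorem exists_representing_operator [CompleteSpace V] [CompleteSpace H] (j : V →L[ℂ] H)
    (a : V →L[ℂ] V →L⋆[ℂ] ℂ) (c : ℝ) :
    ∃ T : V →L[ℂ] V, ∀ u w, inner ℂ (T w) u = a u w + c * inner ℂ (j w) (j u) := by
  refine ⟨InnerProductSpace.continuousLinearMapOfBilin (𝕜 := ℂ) a.flip +
    (c : ℂ) • (j.adjoint.comp j), fun u w => ?_⟩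
  simp only [add_apply, inner_add_left, smul_apply,
    inner_smul_left, ContinuousLinearMap.comp_apply, ContinuousLinearMap.adjoint_inner_left,
    Complex.conj_ofReal]
  rw [InnerProductSpace.continuousLinearMapOfBilin_apply]
  rfl

/-- The shift `ω` in the ellipticity estimate can be taken nonnegative. -/
theorem FormMatrix.IsElliptic.exists_nonneg {j : V →L[ℂ] H} {a : V →L[ℂ] V →L⋆[ℂ] ℂ}
    (ha : FormMatrix.IsElliptic j a) :
    ∃ α : ℝ, 0 < α ∧ ∃ ω : ℝ, 0 ≤ ω ∧ ∀ u : V, α * ‖u‖ ^ 2 ≤ (a u u).re + ω * ‖j u‖ ^ 2 := by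
  obtain ⟨α, hα, ω, h⟩ := ha
  refine ⟨α, hα, max ω 0, le_max_right _ _, fun u => (h u).trans ?_⟩
  gcongr
  exact le_max_left _ _

theorem re_ofReal_mul_inner_self (c : ℝ) (x : H) :
    ((c : ℂ) * inner ℂ x x).re = c * ‖x‖ ^ 2 := by
  rw [Complex.re_ofReal_mul, inner_self_eq_norm_sq_to_K]
  congr 1
  change (((‖x‖ : ℝ) : ℂ) ^ 2).re = _
  rw [← Complex.ofReal_pow, Complex.ofReal_re]

/-- The graph of the operator associated with a form, as a linear relation. -/
def formRelation (j : V →L[ℂ] H) (a : V →L[ℂ] V →L⋆[ℂ] ℂ) : Submodule ℂ (H × H) where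
  carrier := FormMatrix.formOperatorGraph j a
  zero_mem' := ⟨0, by simp, by simp⟩
  add_mem' := by
    rintro p q ⟨u, hu, h⟩ ⟨u', hu', h'⟩
    refine ⟨u + u', by simp [hu, hu'], fun w => ?_⟩
    rw [map_add, add_apply, h, h', Prod.snd_add, ← inner_add_right]
    congr 1
    abel
  smul_mem' := by
    rintro z p ⟨u, hu, h⟩
    refine ⟨z • u, by simp [hu], fun w => ?_⟩
    rw [map_smul, smul_apply, h, Prod.smul_snd, ← smul_neg, inner_smul_right,
      smul_eq_mul]

/-- Beyond the ellipticity shift, the resolvent equation is solved by Lax–Milgram. -/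
theorem range_formRelation [CompleteSpace V] [CompleteSpace H] {j : V →L[ℂ] H}
    {a : V →L[ℂ] V →L⋆[ℂ] ℂ} {α ω : ℝ} (hα : 0 < α)
    (ha : ∀ u : V, α * ‖u‖ ^ 2 ≤ (a u u).re + ω * ‖j u‖ ^ 2) {c : ℝ} (hc : ω < c) (f : H) :
    ∃ p ∈ formRelation j a, c • p.1 - p.2 = f := by
  obtain ⟨T, hT⟩ := exists_representing_operator j a c
  have hcoer : ∀ v, α * ‖v‖ ^ 2 ≤ (inner ℂ (T.adjoint v) v).re := by
    intro v
    rw [ContinuousLinearMap.adjoint_inner_left, ← inner_conj_symm, Complex.conj_re, hT,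
      Complex.add_re, re_ofReal_mul_inner_self]
    nlinarith [ha v, sq_nonneg ‖j v‖]
  obtain ⟨u, hu⟩ := surjective_of_coercive hα hcoer (j.adjoint f)
  refine ⟨(j u, c • j u - f), ⟨u, rfl, fun w => ?_⟩, by simp⟩
  have h1 : inner ℂ (T w) u = inner ℂ (j w) f := by
    rw [← ContinuousLinearMap.adjoint_inner_right, hu, ContinuousLinearMap.adjoint_inner_right]
  rw [hT] at h1
  rw [neg_sub, inner_sub_right, ← h1, ← Complex.coe_smul, inner_smul_right]
  ring

theorem dissipative_formRelation {j : V →L[ℂ] H}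
    {a : V →L[ℂ] V →L⋆[ℂ] ℂ} {α ω : ℝ} (hα : 0 < α)
    (ha : ∀ u : V, α * ‖u‖ ^ 2 ≤ (a u u).re + ω * ‖j u‖ ^ 2) {p : H × H}
    (hp : p ∈ formRelation j a) : (inner ℂ p.1 p.2).re ≤ ω * ‖p.1‖ ^ 2 := by
  obtain ⟨u, hu, h⟩ := hp
  have h1 := h u
  rw [hu, inner_neg_right] at h1
  have h2 := ha u
  rw [h1, hu, Complex.neg_re] at h2
  nlinarith [sq_nonneg ‖u‖, mul_nonneg hα.le (sq_nonneg ‖u‖)]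

theorem dense_fst_formRelation [CompleteSpace V] [CompleteSpace H] {j : V →L[ℂ] H}
    (hj : DenseRange j) {a : V →L[ℂ] V →L⋆[ℂ] ℂ} {α ω : ℝ} (hα : 0 < α)
    (ha : ∀ u : V, α * ‖u‖ ^ 2 ≤ (a u u).re + ω * ‖j u‖ ^ 2) :
    Dense (Prod.fst '' (formRelation j a : Set (H × H))) := by
  have e : Prod.fst '' (formRelation j a : Set (H × H)) =
      ((formRelation j a).map (LinearMap.fst ℂ H H) : Set H) := rfl
  rw [e, Submodule.dense_iff_topologicalClosure_eq_top,
    Submodule.topologicalClosure_eq_top_iff, Submodule.eq_bot_iff]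
  intro f hf
  -- test `f` against the solution of `(ω + 1 - A) x = f`
  obtain ⟨p, hp, hpf⟩ := range_formRelation hα ha (lt_add_one ω) f
  have h0 : inner ℂ p.1 f = 0 := hf _ ⟨p, hp, rfl⟩
  obtain ⟨u, hu, h⟩ := hp
  have h1 := h u
  have h2 : -p.2 = f - (ω + 1) • p.1 := by rw [← hpf]; abel
  rw [hu, h2, inner_sub_right, h0, ← Complex.coe_smul, inner_smul_right] at h1
  have h3 := ha u
  rw [h1, zero_sub, Complex.neg_re, re_ofReal_mul_inner_self, hu] at h3
  have h4 : ‖u‖ ^ 2 ≤ 0 := by nlinarith [sq_nonneg ‖u‖, sq_nonneg ‖p.1‖]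
  have h5 : u = 0 :=
    norm_eq_zero.1 ((pow_eq_zero_iff two_ne_zero).1 (le_antisymm h4 (sq_nonneg _)))
  have h6 : ∀ w, inner ℂ (j w) f = 0 := by
    intro w
    have h7 := h w
    rw [h2, ← hu, h5] at h7
    simpa using h7.symm
  exact hj.induction_on (p := fun x => inner ℂ x f = 0) f
    (isClosed_eq (by fun_prop) continuous_const) h6 |> inner_self_eq_zero.1

/-- An elliptic form on a densely embedded Hilbert space has a semigroup. -/
theorem exists_isFormSemigroup [CompleteSpace V] [CompleteSpace H] {j : V →L[ℂ] H}
    (hj : DenseRange j) {a : V →L[ℂ] V →L⋆[ℂ] ℂ} (ha : FormMatrix.IsElliptic j a) :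
    ∃ S : ℝ≥0 → H →L[ℂ] H, FormMatrix.IsFormSemigroup j a S := by
  obtain ⟨α, hα, ω, hω, h⟩ := ha.exists_nonneg
  exact exists_isC0Semigroup_of_dissipative hω (dense_fst_formRelation hj hα h)
    (fun _ => dissipative_formRelation hα h) (fun _ hc f => range_formRelation hα h hc f)

/-- If `V` splits along `M` and `Mᗮ` and the form vanishes between the two parts, then `M` is
invariant. Writing `Q` for the projection onto `Mᗮ`, the hypothesis gives
`Re ⟨Q x, Q A x⟩ = - Re a(u₂, u₂)` with `u₂` the part of `x` along `Mᗮ`, so that ellipticity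
controls the growth of `Q x` along orbits. -/
theorem invariant_of_form_eq_zero [CompleteSpace V] [CompleteSpace H] {j : V →L[ℂ] H}
    (hj : DenseRange j)
    {a : V →L[ℂ] V →L⋆[ℂ] ℂ} (ha : FormMatrix.IsElliptic j a) {S : ℝ≥0 → H →L[ℂ] H}
    (hS : FormMatrix.IsFormSemigroup j a S) {M : Submodule ℂ H} (hM : IsClosed (M : Set H))
    (hsplit : ∀ u : V, ∃ u₁ u₂ : V, u = u₁ + u₂ ∧ j u₁ ∈ M ∧ j u₂ ∈ Mᗮ)
    (h0 : ∀ u u' : V, j u ∈ M → j u' ∈ Mᗮ → a u u' = 0) (t : ℝ≥0) {x : H} (hx : x ∈ M) :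
    S t x ∈ M := by
  obtain ⟨α, hα, ω, hω, h⟩ := ha.exists_nonneg
  have : CompleteSpace M := hM.completeSpace_coe
  let Q : H →L[ℂ] H := Mᗮ.starProjection
  have hQM : ∀ y ∈ M, Q y = 0 := fun y hy =>
    Submodule.starProjection_orthogonal_apply_eq_zero hy
  have hQM' : ∀ y ∈ Mᗮ, Q y = y := fun y hy => Submodule.starProjection_eq_self_iff.2 hy
  have hdis : ∀ p ∈ FormMatrix.generatorGraph S,
      (inner ℂ (Q p.1) (Q p.2)).re ≤ ω * ‖Q p.1‖ ^ 2 := by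
    intro p hp
    rw [hS.2] at hp
    obtain ⟨u, hu, hau⟩ := hp
    obtain ⟨u₁, u₂, rfl, h₁, h₂⟩ := hsplit u
    have hQ1 : Q p.1 = j u₂ := by
      rw [← hu, map_add, map_add, hQM _ h₁, hQM' _ h₂, zero_add]
    have h3 : inner ℂ (Q p.1) (Q p.2) = inner ℂ (j u₂) p.2 := by
      rw [hQ1, ← Submodule.inner_starProjection_left_eq_right]
      exact congrArg (inner ℂ · p.2) (hQM' _ h₂)
    have h4 := hau u₂
    rw [map_add, add_apply, h0 u₁ u₂ h₁ h₂, zero_add, inner_neg_right] at h4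
    have h5 := h u₂
    rw [h4, Complex.neg_re] at h5
    rw [h3, hQ1]
    nlinarith [mul_nonneg hα.le (sq_nonneg ‖u₂‖)]
  have hdense : Dense (Prod.fst '' FormMatrix.generatorGraph S) := by
    rw [hS.2]; exact dense_fst_formRelation hj hα h
  have hle : ∀ y, ‖Q (S t y)‖ ≤ Real.exp (ω * t) * ‖Q y‖ := by
    intro y
    refine hdense.induction (P := fun y => ‖Q (S t y)‖ ≤ Real.exp (ω * t) * ‖Q y‖) ?_
      (isClosed_le (by fun_prop) (by fun_prop)) y
    rintro _ ⟨p, hp, rfl⟩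
    exact norm_orbit_le_of_dissipative hS.1 Q hdis hp t
  have hx' := hle x
  rw [hQM x hx, norm_zero, mul_zero] at hx'
  have h6 : Q (S t x) = 0 := norm_le_zero_iff.1 hx'
  have h7 : S t x ∈ Mᗮᗮ := (Submodule.starProjection_apply_eq_zero_iff (K := Mᗮ)).1 h6
  rwa [Submodule.orthogonal_orthogonal] at h7

/-- If a closed subspace `M` is invariant under the semigroup, then the form vanishes between
`M` and `Mᗮ`. With `c` above the growth bound, Lax–Milgram on `j⁻¹ M` produces `w` there with
`a_c(·, u') = a_c(·, w)`, where `a_c` is `a` shifted by `c`; testing with the resolvent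
`(c - A)⁻¹ (j w)`, which lies in `M` by invariance, shows `w = 0`. -/
theorem form_eq_zero_of_invariant [CompleteSpace V] [CompleteSpace H] {j : V →L[ℂ] H}
    (hj : Function.Injective j) {a : V →L[ℂ] V →L⋆[ℂ] ℂ} (ha : FormMatrix.IsElliptic j a)
    {S : ℝ≥0 → H →L[ℂ] H} (hS : FormMatrix.IsFormSemigroup j a S) {M : Submodule ℂ H}
    (hM : IsClosed (M : Set H)) (hinv : ∀ t : ℝ≥0, ∀ x ∈ M, S t x ∈ M) {u u' : V}
    (hu : j u ∈ M) (hu' : j u' ∈ Mᗮ) :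
    a u u' = 0 := by
  obtain ⟨α, hα, ω, hω, h⟩ := ha.exists_nonneg
  obtain ⟨T, hT⟩ := exists_representing_operator j a (ω + 1)
  let W : Submodule ℂ V := M.comap (j : V →ₗ[ℂ] H)
  have : CompleteSpace W := (hM.preimage j.continuous).completeSpace_coe
  have : CompleteSpace M := hM.completeSpace_coe
  let T' : W →L[ℂ] W := W.subtypeL.adjoint.comp (T.comp W.subtypeL)
  have hT' : ∀ v, α * ‖v‖ ^ 2 ≤ (inner ℂ (T' v) v).re := by
    intro v
    change _ ≤ (inner ℂ (W.subtypeL.adjoint (T v)) v).re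
    rw [ContinuousLinearMap.adjoint_inner_left, Submodule.subtypeL_apply, hT, Complex.add_re,
      re_ofReal_mul_inner_self]
    have h1 := h v
    rw [Submodule.norm_coe] at h1
    nlinarith [sq_nonneg ‖j (v : V)‖]
  obtain ⟨w, hw⟩ := surjective_of_coercive hα hT' (W.subtypeL.adjoint (T u'))
  have hw' : ∀ v : V, j v ∈ M → inner ℂ (T w) v = inner ℂ (T u') v := by
    intro v hv
    have h1 := congrArg (fun z => inner ℂ z (⟨v, hv⟩ : W)) hw
    change inner ℂ (W.subtypeL.adjoint (T w)) _ = _ at h1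
    simpa only [ContinuousLinearMap.adjoint_inner_left, Submodule.subtypeL_apply] using h1
  have hjw : j w ∈ M := w.2
  have horth : ∀ y ∈ M, inner ℂ (j u') y = 0 := fun y hy => M.inner_left_of_mem_orthogonal hy hu'
  -- the resolvent of `j w`
  obtain ⟨p, hp, hpw⟩ := range_formRelation hα h (lt_add_one ω) (j w)
  have hpS : p ∈ FormMatrix.generatorGraph S := by rw [hS.2]; exact hp
  have hgrow : ∀ t : ℝ≥0, ‖S t p.1‖ ≤ Real.exp (ω * t) * ‖p.1‖ := fun t =>
    norm_orbit_le_of_dissipative hS.1 (ContinuousLinearMap.id ℂ H)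
      (fun q hq => by rw [hS.2] at hq; exact dissipative_formRelation hα h hq) hpS t
  have hpM : p.1 ∈ M := by
    rw [← M.orthogonal_orthogonal]
    intro q hq
    refine inner_eq_zero_of_orbit hS.1 hpS (lt_add_one ω) hgrow fun t => ?_
    rw [hpw]
    exact M.inner_left_of_mem_orthogonal (hinv t _ hjw) hq
  obtain ⟨z, hz, haz⟩ := hp
  have hzM : j z ∈ M := by rw [hz]; exact hpM
  have key : ∀ v, inner ℂ (T v) z = inner ℂ (j v) (j w) := by
    intro v
    rw [hT, haz, hz, ← hpw, inner_neg_right, inner_sub_right, ← Complex.coe_smul,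
      inner_smul_right]
    ring
  have hw0 : j (w : V) = 0 := by
    have h1 := hw' z hzM
    rw [key, key, horth _ hjw] at h1
    exact inner_self_eq_zero.1 h1
  have hw1 : (w : V) = 0 := hj (hw0.trans (map_zero j).symm)
  have h2 := hw' u hu
  rwa [hw1, map_zero, inner_zero_left, hT, horth _ hu, mul_zero, add_zero, eq_comm] at h2

end Form

/-! ### Elementary tensors and orthonormal expansions in `ℓ²(I, E)` -/

section Tensor

variable {I L K : Type*} {E : Type*} [NormedAddCommGroup E] [InnerProductSpace ℂ E]

/-- The elementary tensors `c ⊗ e = (c i • e)_i` with fixed right factor. -/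
noncomputable def tensorRight (I : Type*) (e : E) : ℓ²(I, ℂ) →L[ℂ] ℓ²(I, E) :=
  lp.mapCLM 2 (fun _ => ContinuousLinearMap.toSpanSingleton ℂ e) (norm_nonneg e)
    (fun _ => (ContinuousLinearMap.norm_toSpanSingleton (𝕜 := ℂ) e).le)

theorem tensorRight_apply (e : E) (c : ℓ²(I, ℂ)) (i : I) :
    tensorRight I e c i = c i • e := rfl

theorem inner_tensorRight (e e' : E) (c c' : ℓ²(I, ℂ)) :
    inner ℂ (tensorRight I e c) (tensorRight I e' c') = inner ℂ c c' * inner ℂ e e' := by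
  refine (lp.hasSum_inner (𝕜 := ℂ) (tensorRight I e c) (tensorRight I e' c')).unique ?_
  convert! (lp.hasSum_inner (𝕜 := ℂ) c c').mul_right (inner ℂ e e') using 2 with i
  rw [tensorRight_apply, tensorRight_apply, inner_smul_left, inner_smul_right]
  simp only [RCLike.inner_apply]
  ring

theorem norm_tensorRight (e : E) (c : ℓ²(I, ℂ)) : ‖tensorRight I e c‖ = ‖c‖ * ‖e‖ := by
  have h := inner_tensorRight e e c c
  simp only [inner_self_eq_norm_sq_to_K] at h
  rw [← mul_pow] at h
  refine (sq_eq_sq₀ (norm_nonneg _) (by positivity)).1 ?_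
  exact_mod_cast h

/-- The elementary tensors `c ⊗ e = (c i • e)_i` with fixed left factor. -/
noncomputable def tensorLeft (E : Type*) [NormedAddCommGroup E] [InnerProductSpace ℂ E]
    (c : ℓ²(I, ℂ)) : E →L[ℂ] ℓ²(I, E) :=
  LinearMap.mkContinuous
    { toFun := fun e => tensorRight I e c
      map_add' := fun e e' => by ext i; simp [tensorRight_apply]
      map_smul' := fun z e => by ext i; simp [tensorRight_apply, smul_smul, mul_comm] }
    ‖c‖ fun e => (norm_tensorRight e c).le

theorem tensorLeft_apply (c : ℓ²(I, ℂ)) (e : E) : tensorLeft E c e = tensorRight I e c := rfl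

/-- A unit vector `c` gives an isometric embedding `e ↦ c ⊗ e`. -/
noncomputable def tensorIsometry (E : Type*) [NormedAddCommGroup E] [InnerProductSpace ℂ E]
    (c : ℓ²(I, ℂ)) (hc : ‖c‖ = 1) : E →ₗᵢ[ℂ] ℓ²(I, E) where
  toLinearMap := tensorLeft E c
  norm_map' e := (norm_tensorRight e c).trans (by rw [hc, one_mul])

theorem tensorIsometry_apply (c : ℓ²(I, ℂ)) (hc : ‖c‖ = 1) (e : E) :
    tensorIsometry E c hc e = tensorRight I e c := rfl

theorem orthogonalFamily_tensorIsometry (E : Type*) [NormedAddCommGroup E] [InnerProductSpace ℂ E]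
    {v : L → ℓ²(I, ℂ)} (hv : Orthonormal ℂ v) :
    OrthogonalFamily ℂ (fun _ : L => E) fun l => tensorIsometry E (v l) (hv.1 l) := by
  intro l l' hl e e'
  rw [tensorIsometry_apply, tensorIsometry_apply, inner_tensorRight, hv.2 hl, zero_mul]

variable [CompleteSpace E]

/-- The isometry `(ψ_ℓ) ↦ ∑ v_ℓ ⊗ ψ_ℓ` from `ℓ²(L, E)` to `ℓ²(I, E)` defined by an orthonormal
family `v`. -/
noncomputable def synthesis (E : Type*) [NormedAddCommGroup E] [InnerProductSpace ℂ E]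
    [CompleteSpace E] {v : L → ℓ²(I, ℂ)} (hv : Orthonormal ℂ v) : ℓ²(L, E) →ₗᵢ[ℂ] ℓ²(I, E) :=
  (orthogonalFamily_tensorIsometry E hv).linearIsometry

theorem hasSum_synthesis {v : L → ℓ²(I, ℂ)} (hv : Orthonormal ℂ v) (ψ : ℓ²(L, E)) :
    HasSum (fun l => tensorRight I (ψ l) (v l)) (synthesis E hv ψ) :=
  (orthogonalFamily_tensorIsometry E hv).hasSum_linearIsometry ψ

theorem hasSum_synthesis_apply {v : L → ℓ²(I, ℂ)} (hv : Orthonormal ℂ v) (ψ : ℓ²(L, E)) (i : I) :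
    HasSum (fun l => v l i • ψ l) (synthesis E hv ψ i) := by
  have h := (hasSum_synthesis hv ψ).mapL (lp.evalCLM ℂ (fun _ : I => E) 2 i)
  exact h

open scoped Classical in
theorem synthesis_single {v : L → ℓ²(I, ℂ)} (hv : Orthonormal ℂ v) (l : L) (e : E) :
    synthesis E hv (lp.single 2 l e) = tensorRight I e (v l) :=
  (orthogonalFamily_tensorIsometry E hv).linearIsometry_apply_single e

theorem sumEmbedding_synthesis {F : Type*} [NormedAddCommGroup F] [InnerProductSpace ℂ F]
    [CompleteSpace F] (φ : E →L[ℂ] F) {v : L → ℓ²(I, ℂ)} (hv : Orthonormal ℂ v) (ψ : ℓ²(L, E)) :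
    FormMatrix.sumEmbedding I φ (synthesis E hv ψ) =
      synthesis F hv (FormMatrix.sumEmbedding L φ ψ) := by
  ext i
  refine HasSum.unique ?_ (hasSum_synthesis_apply hv (FormMatrix.sumEmbedding L φ ψ) i)
  have h := (hasSum_synthesis_apply hv ψ i).mapL φ
  simp only [map_smul] at h
  exact h

theorem inner_synthesis_synthesis {v : L → ℓ²(I, ℂ)} (hv : Orthonormal ℂ v) {w : K → ℓ²(I, ℂ)}
    (hw : Orthonormal ℂ w) (hvw : ∀ l k, inner ℂ (v l) (w k) = 0) (ψ : ℓ²(L, E))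
    (ψ' : ℓ²(K, E)) : inner ℂ (synthesis E hv ψ) (synthesis E hw ψ') = 0 := by
  have h1 : ∀ l, inner ℂ (tensorRight I (ψ l) (v l)) (synthesis E hw ψ') = 0 := fun l => by
    refine (((innerSL ℂ (tensorRight I (ψ l) (v l))).hasSum (hasSum_synthesis hw ψ')).unique ?_)
    convert! hasSum_zero using 2 with k
    simp [inner_tensorRight, hvw]
  rw [← inner_conj_symm, map_eq_zero]
  refine (((innerSL ℂ (synthesis E hw ψ')).hasSum (hasSum_synthesis hv ψ)).unique ?_)
  convert! hasSum_zero using 2 with l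
  rw [innerSL_apply_apply, ← inner_conj_symm, h1, map_zero]

/-- A continuous functional that vanishes on a Hilbert basis of `Y` vanishes on `Y`. -/
theorem HilbertBasis.apply_eq_zero {Y : Submodule ℂ ℓ²(I, ℂ)} (v : HilbertBasis L ℂ Y)
    {f : ℓ²(I, ℂ) →L[ℂ] ℂ} (hf : ∀ l, f (v l) = 0) {c : ℓ²(I, ℂ)} (hc : c ∈ Y) : f c = 0 := by
  have h1 : (f.comp Y.subtypeL) = 0 := by
    refine ContinuousLinearMap.ext_on
      (Submodule.dense_iff_topologicalClosure_eq_top.2 v.dense_span) ?_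
    rintro _ ⟨l, rfl⟩
    exact hf l
  exact DFunLike.congr_fun h1 (⟨c, hc⟩ : Y)

theorem HilbertBasis.orthonormal_coe {Y : Submodule ℂ ℓ²(I, ℂ)} (v : HilbertBasis L ℂ Y) :
    Orthonormal ℂ fun l => (v l : ℓ²(I, ℂ)) :=
  v.orthonormal.comp_linearIsometry Y.subtypeₗᵢ

/-- Orthonormal bases of `Y` and `Yᗮ` together split `ℓ²(I, E)` as the sum of the two ranges of the
synthesis isometries. -/
theorem exists_eq_synthesis_add_synthesis {Y : Submodule ℂ ℓ²(I, ℂ)}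
    (hY : IsClosed (Y : Set ℓ²(I, ℂ))) (v : HilbertBasis L ℂ Y) (w : HilbertBasis K ℂ Yᗮ)
    (u : ℓ²(I, E)) : ∃ (ψ : ℓ²(L, E)) (ψ' : ℓ²(K, E)),
      u = synthesis E v.orthonormal_coe ψ + synthesis E w.orthonormal_coe ψ' := by
  classical
  have : CompleteSpace Y := hY.completeSpace_coe
  let Rv : Submodule ℂ ℓ²(I, E) := (synthesis E v.orthonormal_coe).range
  let Rw : Submodule ℂ ℓ²(I, E) := (synthesis E w.orthonormal_coe).range
  have hcv : CompleteSpace Rv :=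
    (synthesis E v.orthonormal_coe).isometry.isClosedEmbedding.isClosed_range.completeSpace_coe
  have hcw : CompleteSpace Rw :=
    (synthesis E w.orthonormal_coe).isometry.isClosedEmbedding.isClosed_range.completeSpace_coe
  have horth : ∀ x ∈ Rv, ∀ y ∈ Rw, inner ℂ x y = 0 := by
    rintro _ ⟨ψ, rfl⟩ _ ⟨ψ', rfl⟩
    exact inner_synthesis_synthesis _ _
      (fun l k => Y.inner_right_of_mem_orthogonal (v l).2 (w k).2) ψ ψ'
  set r := u - Rv.starProjection u - Rw.starProjection u with hr
  have hPv : Rv.starProjection u ∈ Rv := Submodule.starProjection_apply_mem _ _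
  have hPw : Rw.starProjection u ∈ Rw := Submodule.starProjection_apply_mem _ _
  have hrv : ∀ x ∈ Rv, inner ℂ r x = 0 := by
    intro x hx
    have h1 : inner ℂ (u - Rv.starProjection u) x = 0 :=
      Submodule.starProjection_inner_eq_zero u x hx
    rw [hr, inner_sub_left, h1, ← inner_conj_symm, horth _ hx _ hPw, map_zero, sub_zero]
  have hrw : ∀ x ∈ Rw, inner ℂ r x = 0 := by
    intro x hx
    have h1 : inner ℂ (u - Rw.starProjection u) x = 0 :=
      Submodule.starProjection_inner_eq_zero u x hx
    rw [hr, sub_right_comm, inner_sub_left, h1, horth _ hPv _ hx, sub_zero]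
  -- `c ↦ ⟨r, c ⊗ e⟩` vanishes on `Y` and on `Yᗮ`, hence everywhere
  have hall : ∀ (e : E) (c : ℓ²(I, ℂ)), inner ℂ r (tensorRight I e c) = 0 := by
    intro e c
    let f : ℓ²(I, ℂ) →L[ℂ] ℂ := (innerSL ℂ r).comp (tensorRight I e)
    obtain ⟨y, hy, z, hz, rfl⟩ := Y.exists_add_mem_mem_orthogonal c
    have h1 : f y = 0 := v.apply_eq_zero (fun l => hrv _ ⟨_, synthesis_single _ l e⟩) hy
    have h2 : f z = 0 := w.apply_eq_zero (fun k => hrw _ ⟨_, synthesis_single _ k e⟩) hz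
    change f (y + z) = 0
    rw [map_add, h1, h2, add_zero]
  have hr0 : r = 0 := by
    ext i
    have h1 := hall (r i) (lp.single 2 i 1)
    have h2 : tensorRight I (r i) (lp.single 2 i 1) = lp.single 2 i (r i) := by
      ext j
      rw [tensorRight_apply]
      rcases eq_or_ne j i with rfl | hj
      · simp
      · rw [lp.single_apply_ne _ _ _ hj, lp.single_apply_ne _ _ _ hj, zero_smul]
    rw [h2, lp.inner_single_right] at h1
    exact inner_self_eq_zero.1 h1
  obtain ⟨ψ, hψ⟩ := hPv
  obtain ⟨ψ', hψ'⟩ := hPw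
  refine ⟨ψ, ψ', ?_⟩
  have h3 : u = Rv.starProjection u + Rw.starProjection u := by
    rw [← sub_eq_zero, ← sub_sub]; exact hr0
  rw [h3, ← hψ, ← hψ']
  rfl

/-- The coefficient of `u` along `c`, that is `∑ i, conj (c i) • u i`. -/
noncomputable def coefficient (E : Type*) [NormedAddCommGroup E] [InnerProductSpace ℂ E]
    [CompleteSpace E] (c : ℓ²(I, ℂ)) : ℓ²(I, E) →L[ℂ] E :=
  (tensorLeft E c).adjoint

theorem hasSum_coefficient (c : ℓ²(I, ℂ)) (u : ℓ²(I, E)) :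
    HasSum (fun i => starRingEnd ℂ (c i) • u i) (coefficient E c u) := by
  classical
  convert! (coefficient E c).hasSum (lp.hasSum_single (by simp) u) using 2 with i
  refine ext_inner_left ℂ fun e => ?_
  rw [coefficient, ContinuousLinearMap.adjoint_inner_right,
    lp.inner_single_right, tensorLeft_apply, tensorRight_apply, inner_smul_left, inner_smul_right]

theorem coefficient_synthesis {w : K → ℓ²(I, ℂ)} (hw : Orthonormal ℂ w) (k : K) (ψ : ℓ²(K, E)) :
    coefficient E (w k) (synthesis E hw ψ) = ψ k := by
  classical
  refine ext_inner_left ℂ fun e => ?_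
  rw [coefficient, ContinuousLinearMap.adjoint_inner_right, tensorLeft_apply,
    ← synthesis_single hw, LinearIsometry.inner_map_map, lp.inner_single_left]

theorem coefficient_synthesis_eq_zero {v : L → ℓ²(I, ℂ)} (hv : Orthonormal ℂ v) {c : ℓ²(I, ℂ)}
    (hc : ∀ l, inner ℂ c (v l) = 0) (ψ : ℓ²(L, E)) : coefficient E c (synthesis E hv ψ) = 0 := by
  refine ext_inner_left ℂ fun e => ?_
  rw [coefficient, ContinuousLinearMap.adjoint_inner_right, tensorLeft_apply, inner_zero_right]
  refine ((innerSL ℂ (tensorRight I e c)).hasSum (hasSum_synthesis hv ψ)).unique ?_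
  convert! hasSum_zero using 2 with l
  simp [inner_tensorRight, hc]

end Tensor

/-! ### The multiple series -/

section MatrixSum

variable {I L K : Type*} {E : Type*} [NormedAddCommGroup E] [InnerProductSpace ℂ E]

theorem lp_two_summable_sq_norm {F : Type*} [NormedAddCommGroup F] (ψ : ℓ²(L, F)) :
    Summable fun l => ‖ψ l‖ ^ 2 := by
  convert! (lp.memℓp ψ).summable (by simp) using 2 with l
  simp

/-- The components of an expansion along an orthonormal family converge absolutely, by Bessel's
inequality and Cauchy–Schwarz. -/
theorem summable_norm_smul_of_orthonormal {v : L → ℓ²(I, ℂ)} (hv : Orthonormal ℂ v)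
    (ψ : ℓ²(L, E)) (i : I) : Summable fun l => ‖v l i • ψ l‖ := by
  classical
  have h1 := hv.inner_products_summable (x := lp.single 2 i 1)
  have h2 : Summable fun l => ‖v l i‖ ^ 2 := by
    convert h1 using 3 with l
    rw [lp.inner_single_right]
    simp
  refine Summable.of_nonneg_of_le (fun _ => norm_nonneg _) (fun l => ?_)
    (h2.add (lp_two_summable_sq_norm ψ))
  rw [norm_smul]
  nlinarith [sq_nonneg (‖v l i‖ - ‖ψ l‖), sq_nonneg (‖v l i‖ + ‖ψ l‖)]

/-- A continuous sesquilinear form evaluated on two absolutely convergent series. -/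
theorem hasSum_form_of_summable_norm (b : E →L[ℂ] E →L⋆[ℂ] ℂ) {f : L → E} {g : K → E} {x y : E}
    (hf : HasSum f x) (hg : HasSum g y) (hf' : Summable fun l => ‖f l‖)
    (hg' : Summable fun k => ‖g k‖) :
    HasSum (fun p : L × K => b (f p.1) (g p.2)) (b x y) := by
  have hs : Summable fun p : L × K => b (f p.1) (g p.2) := by
    refine Summable.of_norm_bounded ((hf'.mul_of_nonneg hg' (fun _ => norm_nonneg _)
      (fun _ => norm_nonneg _)).mul_left ‖b‖) fun p => ?_
    rw [← mul_assoc]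
    exact b.le_opNorm₂ _ _
  have h1 : ∀ l, HasSum (fun k => b (f l) (g k)) (b (f l) y) := fun l => (b (f l)).hasSum hg
  have h2 : HasSum (fun l => b (f l) y) (b x y) := (b.flip y).hasSum hf
  rw [← (hs.hasSum.prod_fiberwise h1).unique h2]
  exact hs.hasSum

theorem hasMatrixSum_unique {a : ℓ²(I, E) →L[ℂ] ℓ²(I, E) →L⋆[ℂ] ℂ} {v : L → ℓ²(I, ℂ)}
    {w : K → ℓ²(I, ℂ)} {ψ : L → E} {ψ' : K → E} {s s' : ℂ}
    (h : FormMatrix.HasMatrixSum a v w ψ ψ' s) (h' : FormMatrix.HasMatrixSum a v w ψ ψ' s') :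
    s = s' := by
  obtain ⟨c, d, hc, hd, hs⟩ := h
  obtain ⟨c', d', hc', hd', hs'⟩ := h'
  obtain rfl : c = c' := funext₂ fun i j => (hc i j).unique (hc' i j)
  obtain rfl : d = d' := funext fun i => (hd i).unique (hd' i)
  exact hs.unique hs'

/-- The multiple series converges to the value of the form at the two synthesized vectors. -/
theorem hasMatrixSum_synthesis [CompleteSpace E]
    (a : ℓ²(I, E) →L[ℂ] ℓ²(I, E) →L⋆[ℂ] ℂ) {v : L → ℓ²(I, ℂ)}
    (hv : Orthonormal ℂ v) {w : K → ℓ²(I, ℂ)} (hw : Orthonormal ℂ w) (ψ : ℓ²(L, E))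
    (ψ' : ℓ²(K, E)) :
    FormMatrix.HasMatrixSum a v w ψ ψ' (a (synthesis E hv ψ) (synthesis E hw ψ')) := by
  classical
  set u := synthesis E hv ψ with hu
  set u' := synthesis E hw ψ' with hu'
  refine ⟨fun i j => a (lp.single 2 j (u j)) (lp.single 2 i (u' i)),
    fun i => a u (lp.single 2 i (u' i)), fun i j => ?_, fun i => ?_, ?_⟩
  · have hsv := (hasSum_synthesis_apply hv ψ j).mapL
      (lp.singleContinuousLinearMap ℂ (fun _ : I => E) 2 j)
    have hsw := (hasSum_synthesis_apply hw ψ' i).mapL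
      (lp.singleContinuousLinearMap ℂ (fun _ : I => E) 2 i)
    simp only [lp.singleContinuousLinearMap_apply] at hsv hsw
    have h := hasSum_form_of_summable_norm a hsv hsw
      (by simpa only [lp.norm_single zero_lt_two] using summable_norm_smul_of_orthonormal hv ψ j)
      (by simpa only [lp.norm_single zero_lt_two] using summable_norm_smul_of_orthonormal hw ψ' i)
    convert! h using 2 with p
    have e : ∀ (x y : ℓ²(I, E)) (z z' : ℂ), a (z • x) (z' • y) = z * starRingEnd ℂ z' * a x y := by
      intro x y z z'
      rw [map_smulₛₗ (a (z • x)), map_smul, smul_apply, smul_eq_mul, smul_eq_mul]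
      ring
    rw [lp.single_smul, lp.single_smul, e]
    rfl
  · exact (a.flip (lp.single 2 i (u' i))).hasSum (lp.hasSum_single (by simp) u)
  · exact (a u).hasSum (lp.hasSum_single (by simp) u')

end MatrixSum

/-! ### Subspace-valued functions -/

section Valued

variable {I L K : Type*} {X : Type*} [MeasurableSpace X] {μ : Measure X}

/-- An orthonormal family in `ℓ²(I)` with `I` countable is countable: by Bessel's inequality only
countably many members have a nonzero `i`-th component. -/
theorem countable_of_orthonormal_lp [Countable I] {w : K → ℓ²(I, ℂ)} (hw : Orthonormal ℂ w) :
    Countable K := by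
  classical
  have h1 : ∀ i, {k | w k i ≠ 0}.Countable := by
    intro i
    refine (hw.inner_products_summable (x := lp.single 2 i 1)).countable_support.mono fun k hk => ?_
    rw [Function.mem_support, lp.inner_single_right]
    simpa using hk
  refine Set.countable_univ_iff.1 ((Set.countable_iUnion h1).mono fun k _ => ?_)
  by_contra h
  have h2 : w k = 0 := by
    ext i
    by_contra h3
    exact h (Set.mem_iUnion.2 ⟨i, h3⟩)
  exact hw.ne_zero k h2

/-- A square-summable family in `L²` is almost everywhere a square-summable family of numbers. -/
theorem ae_memℓp [Countable I] (ψ : ℓ²(I, Lp ℂ 2 μ)) :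
    ∀ᵐ x ∂μ, Memℓp (fun i => (ψ i : X → ℂ) x) 2 := by
  have hm : ∀ i, AEMeasurable (fun x => ‖(ψ i : X → ℂ) x‖ₑ ^ (2 : ℝ)) μ := fun i =>
    (Lp.aestronglyMeasurable (ψ i)).enorm.pow_const _
  have h1 : ∀ i, ∫⁻ x, ‖(ψ i : X → ℂ) x‖ₑ ^ (2 : ℝ) ∂μ = ENNReal.ofReal (‖ψ i‖ ^ 2) := by
    intro i
    have h2 := eLpNorm_eq_lintegral_rpow_enorm_toReal (μ := μ) (f := (ψ i : X → ℂ)) (p := 2)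
      two_ne_zero ENNReal.ofNat_ne_top
    simp only [ENNReal.toReal_ofNat] at h2
    rw [Lp.norm_def, ← ENNReal.toReal_pow, ENNReal.ofReal_toReal
      (ENNReal.pow_ne_top (Lp.eLpNorm_ne_top _)), h2, ← ENNReal.rpow_natCast, ← ENNReal.rpow_mul]
    norm_num
  have h2 : ∫⁻ x, ∑' i, ‖(ψ i : X → ℂ) x‖ₑ ^ (2 : ℝ) ∂μ ≠ ⊤ := by
    rw [lintegral_tsum hm]
    simp only [h1]
    rw [← ENNReal.ofReal_tsum_of_nonneg (fun _ => by positivity) (lp_two_summable_sq_norm ψ)]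
    exact ENNReal.ofReal_ne_top
  filter_upwards [ae_lt_top' (AEMeasurable.tsum hm) h2] with x hx
  refine memℓp_gen ?_
  have h3 := ENNReal.summable_toReal hx.ne
  convert h3 using 2 with i
  simp

/-- The partial sums of an unconditionally convergent series in `L²` converge almost everywhere
along a subsequence. -/
theorem exists_seq_tendsto_ae_of_hasSum [Countable I] {f : I → Lp ℂ 2 μ} {g : Lp ℂ 2 μ}
    (h : HasSum f g) : ∃ ns : ℕ → Finset I, Tendsto ns atTop atTop ∧
      ∀ᵐ x ∂μ, Tendsto (fun n => ∑ i ∈ ns n, (f i : X → ℂ) x) atTop (𝓝 ((g : X → ℂ) x)) := by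
  obtain ⟨ns, hns, hlim⟩ := (tendstoInMeasure_of_tendsto_Lp h).exists_seq_tendsto_ae'
  refine ⟨ns, hns, ?_⟩
  have h1 : ∀ᵐ x ∂μ, ∀ n, ((∑ i ∈ ns n, f i : Lp ℂ 2 μ) : X → ℂ) x =
      ∑ i ∈ ns n, (f i : X → ℂ) x := by
    refine ae_all_iff.2 fun n => ?_
    filter_upwards [Lp.coeFn_finsetSum (ns n) f] with x hx
    rw [hx, Finset.sum_apply]
  filter_upwards [hlim, h1] with x hx hx1
  simpa only [hx1] using hx

/-- The coefficient of `ψ` along `c` is computed pointwise: it is `x ↦ ⟨c, ψ(x)⟩` wherever `ψ(x)`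
is square-summable. -/
theorem ae_coefficient_eq_inner [Countable I] (ψ : ℓ²(I, Lp ℂ 2 μ)) (c : ℓ²(I, ℂ)) :
    ∀ᵐ x ∂μ, ∀ y : ℓ²(I, ℂ), (∀ i, (ψ i : X → ℂ) x = y i) →
      (coefficient (Lp ℂ 2 μ) c ψ : X → ℂ) x = inner ℂ c y := by
  obtain ⟨ns, hns, hlim⟩ := exists_seq_tendsto_ae_of_hasSum (hasSum_coefficient c ψ)
  have h1 : ∀ᵐ x ∂μ, ∀ i, ((starRingEnd ℂ (c i) • ψ i : Lp ℂ 2 μ) : X → ℂ) x =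
      starRingEnd ℂ (c i) • (ψ i : X → ℂ) x :=
    ae_all_iff.2 fun i => Lp.coeFn_smul _ _
  filter_upwards [hlim, h1] with x hx hx1 y hy
  simp only [hx1, hy] at hx
  refine tendsto_nhds_unique hx ?_
  have h2 := (lp.hasSum_inner (𝕜 := ℂ) c y).comp hns
  refine h2.congr fun n => Finset.sum_congr rfl fun i _ => ?_
  change inner ℂ (c i) (y i) = _
  rw [RCLike.inner_apply, smul_eq_mul, mul_comm]

/-- Membership in `valuedIn μ Y` is the vanishing of all coefficients along an orthonormal basis of
`Yᗮ`; that basis is countable, so the exceptional null sets can be collected. -/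
theorem mem_valuedIn_iff [Countable I] {Y : Submodule ℂ ℓ²(I, ℂ)}
    (hY : IsClosed (Y : Set ℓ²(I, ℂ))) (w : HilbertBasis K ℂ Yᗮ) (ψ : ℓ²(I, Lp ℂ 2 μ)) :
    ψ ∈ FormMatrix.valuedIn μ Y ↔ ∀ k, coefficient (Lp ℂ 2 μ) (w k : ℓ²(I, ℂ)) ψ = 0 := by
  have : CompleteSpace Y := hY.completeSpace_coe
  have : Countable K := countable_of_orthonormal_lp w.orthonormal_coe
  have hco : ∀ᵐ x ∂μ, ∀ k, ∀ y : ℓ²(I, ℂ), (∀ i, (ψ i : X → ℂ) x = y i) →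
      (coefficient (Lp ℂ 2 μ) (w k : ℓ²(I, ℂ)) ψ : X → ℂ) x = inner ℂ (w k : ℓ²(I, ℂ)) y :=
    ae_all_iff.2 fun k => ae_coefficient_eq_inner ψ _
  constructor
  · intro hψ k
    refine (Lp.eq_zero_iff_ae_eq_zero).2 ?_
    filter_upwards [hψ, hco] with x ⟨y, hyY, hy⟩ hx
    rw [hx k y hy]
    exact Y.inner_left_of_mem_orthogonal hyY (w k).2
  · intro h
    have h0 : ∀ᵐ x ∂μ, ∀ k,
        (coefficient (Lp ℂ 2 μ) (w k : ℓ²(I, ℂ)) ψ : X → ℂ) x = 0 := by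
      refine ae_all_iff.2 fun k => ?_
      rw [h k]
      exact Lp.coeFn_zero ℂ 2 μ
    change ∀ᵐ x ∂μ, ∃ y ∈ Y, ∀ i : I, (ψ i : X → ℂ) x = y i
    filter_upwards [ae_memℓp ψ, hco, h0] with x hx hx1 hx0
    let y : ℓ²(I, ℂ) := ⟨fun i => (ψ i : X → ℂ) x, hx⟩
    refine ⟨y, ?_, fun i => rfl⟩
    rw [← Y.orthogonal_orthogonal]
    intro z hz
    have h1 : ∀ k, innerSL ℂ y (w k : ℓ²(I, ℂ)) = 0 := fun k => by
      rw [innerSL_apply_apply, ← inner_conj_symm, ← hx1 k y (fun _ => rfl), hx0 k, map_zero]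
    have h2 : innerSL ℂ y z = 0 := w.apply_eq_zero h1 hz
    rw [innerSL_apply_apply] at h2
    rw [← inner_conj_symm, h2, map_zero]

/-- The functions with values in `Y` are the expansions along an orthonormal basis of `Y` with
coefficients in `L²`. -/
theorem valuedIn_eq_range_synthesis [Countable I] {Y : Submodule ℂ ℓ²(I, ℂ)}
    (hY : IsClosed (Y : Set ℓ²(I, ℂ))) (v : HilbertBasis L ℂ Y) (w : HilbertBasis K ℂ Yᗮ) :
    (FormMatrix.valuedIn μ Y : Set ℓ²(I, Lp ℂ 2 μ)) =
      Set.range (synthesis (Lp ℂ 2 μ) v.orthonormal_coe) := by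
  ext ψ
  rw [SetLike.mem_coe, mem_valuedIn_iff hY w]
  have hv0 : ∀ k (α : ℓ²(L, Lp ℂ 2 μ)), coefficient (Lp ℂ 2 μ) (w k : ℓ²(I, ℂ))
      (synthesis (Lp ℂ 2 μ) v.orthonormal_coe α) = 0 := fun k α =>
    coefficient_synthesis_eq_zero v.orthonormal_coe
      (fun l => Y.inner_left_of_mem_orthogonal (v l).2 (w k).2) α
  constructor
  · intro h
    obtain ⟨α, β, rfl⟩ := exists_eq_synthesis_add_synthesis hY v w ψ
    have hβ : β = 0 := by
      ext1
      funext k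
      have h1 := h k
      rwa [map_add, hv0, zero_add, coefficient_synthesis w.orthonormal_coe] at h1
    exact ⟨α, by rw [hβ, map_zero, add_zero]⟩
  · rintro ⟨α, rfl⟩ k
    exact hv0 k α

theorem denseRange_sumEmbedding {E F : Type*} [NormedAddCommGroup E] [InnerProductSpace ℂ E]
    [NormedAddCommGroup F] [InnerProductSpace ℂ F] {φ : E →L[ℂ] F} (hφ : DenseRange φ) :
    DenseRange (FormMatrix.sumEmbedding I φ) := by
  classical
  -- the closure of the range contains every `lp.single`, and these have dense span
  have hsingle : ∀ (i : I) (f : F),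
      lp.single 2 i f ∈ (FormMatrix.sumEmbedding I φ).range.topologicalClosure := by
    intro i f
    refine hφ.induction_on (p := fun f => (lp.single 2 i f : ℓ²(I, F)) ∈
      (FormMatrix.sumEmbedding I φ).range.topologicalClosure) f ?_ fun e => ?_
    · exact (Submodule.isClosed_topologicalClosure _).preimage
        (lp.isometry_single (E := fun _ : I => F) (p := 2) i).continuous
    · refine Submodule.le_topologicalClosure _ ⟨lp.single 2 i e, ?_⟩
      ext k
      change φ ((lp.single 2 i e : ℓ²(I, E)) k) = (lp.single 2 i (φ e) : ℓ²(I, F)) k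
      rcases eq_or_ne k i with rfl | hk
      · simp
      · rw [lp.single_apply_ne _ _ _ hk, lp.single_apply_ne _ _ _ hk, map_zero]
  intro u
  change u ∈ ((FormMatrix.sumEmbedding I φ).range.topologicalClosure : Set ℓ²(I, F))
  exact (Submodule.isClosed_topologicalClosure _).mem_of_tendsto
    (lp.hasSum_single (by simp) u)
    (Eventually.of_forall fun s => Submodule.sum_mem _ fun i _ => hsingle i (u i))

end Valued

theorem mainTheorem2
    {I : Type*} [Countable I]
    {X : Type*} [MeasurableSpace X] (μ : Measure X) [SigmaFinite μ]
    {V₀ : Type*} [NormedAddCommGroup V₀] [InnerProductSpace ℂ V₀] [CompleteSpace V₀]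
    (φ : V₀ →L[ℂ] Lp ℂ 2 μ) (hφ_inj : Function.Injective φ) (hφ_dense : DenseRange φ)
    (a : ℓ²(I, V₀) →L[ℂ] ℓ²(I, V₀) →L⋆[ℂ] ℂ)
    (ha : FormMatrix.IsElliptic (FormMatrix.sumEmbedding I φ) a)
    (Y : Submodule ℂ ℓ²(I, ℂ)) (hY : IsClosed (Y : Set ℓ²(I, ℂ))) :
    (∃ S : ℝ≥0 → ℓ²(I, Lp ℂ 2 μ) →L[ℂ] ℓ²(I, Lp ℂ 2 μ),
      FormMatrix.IsFormSemigroup (FormMatrix.sumEmbedding I φ) a S) ∧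
    ∀ S : ℝ≥0 → ℓ²(I, Lp ℂ 2 μ) →L[ℂ] ℓ²(I, Lp ℂ 2 μ),
      FormMatrix.IsFormSemigroup (FormMatrix.sumEmbedding I φ) a S →
      ∀ {L K : Type*} (v : HilbertBasis L ℂ Y) (w : HilbertBasis K ℂ Yᗮ),
        (∀ t : ℝ≥0, ∀ ψ ∈ FormMatrix.valuedIn μ Y, S t ψ ∈ FormMatrix.valuedIn μ Y) ↔
        ∀ (ψ : ℓ²(L, V₀)) (ψ' : ℓ²(K, V₀)),
          FormMatrix.HasMatrixSum a (fun l => (v l : ℓ²(I, ℂ))) (fun k => (w k : ℓ²(I, ℂ)))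
            ψ ψ' 0 := by
  have hinj : Function.Injective (FormMatrix.sumEmbedding I φ) := by
    intro u u' h
    ext1
    funext i
    exact hφ_inj (congrArg (fun z : ℓ²(I, Lp ℂ 2 μ) => z i) h)
  have hdense : DenseRange (FormMatrix.sumEmbedding I φ) := denseRange_sumEmbedding hφ_dense
  refine ⟨exists_isFormSemigroup hdense ha, fun S hS L K v w => ?_⟩
  set j := FormMatrix.sumEmbedding I φ with hj
  have hrange := valuedIn_eq_range_synthesis (μ := μ) hY v w
  have hclosed : IsClosed (FormMatrix.valuedIn μ Y : Set ℓ²(I, Lp ℂ 2 μ)) := by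
    rw [hrange]
    exact (synthesis _ v.orthonormal_coe).isometry.isClosedEmbedding.isClosed_range
  have hv : ∀ ψ : ℓ²(L, V₀), j (synthesis V₀ v.orthonormal_coe ψ) ∈ FormMatrix.valuedIn μ Y := by
    intro ψ
    rw [hj, sumEmbedding_synthesis, ← SetLike.mem_coe, hrange]
    exact ⟨_, rfl⟩
  have hw : ∀ ψ' : ℓ²(K, V₀),
      j (synthesis V₀ w.orthonormal_coe ψ') ∈ (FormMatrix.valuedIn μ Y)ᗮ := by
    intro ψ' x hx
    rw [← SetLike.mem_coe, hrange] at hx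
    obtain ⟨α, rfl⟩ := hx
    rw [hj, sumEmbedding_synthesis]
    exact inner_synthesis_synthesis _ _
      (fun l k => Y.inner_right_of_mem_orthogonal (v l).2 (w k).2) _ _
  have heq_zero : ∀ x ∈ FormMatrix.valuedIn μ Y, x ∈ (FormMatrix.valuedIn μ Y)ᗮ → x = 0 :=
    fun x hx hx' => inner_self_eq_zero.1 (hx' x hx)
  constructor
  · intro h ψ ψ'
    have h0 := form_eq_zero_of_invariant hinj ha hS hclosed h (hv ψ) (hw ψ')
    have h1 := hasMatrixSum_synthesis a v.orthonormal_coe w.orthonormal_coe ψ ψ'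
    rwa [h0] at h1
  · intro h t x hx
    refine invariant_of_form_eq_zero hdense ha hS hclosed (fun u => ?_) (fun u u' hu hu' => ?_) t hx
    · obtain ⟨ψ, ψ', rfl⟩ := exists_eq_synthesis_add_synthesis hY v w u
      exact ⟨_, _, rfl, hv ψ, hw ψ'⟩
    · obtain ⟨ψ₁, ψ₁', rfl⟩ := exists_eq_synthesis_add_synthesis hY v w u
      obtain ⟨ψ₂, ψ₂', rfl⟩ := exists_eq_synthesis_add_synthesis hY v w u'
      -- injectivity of the embedding removes the components in the wrong summand
      have h1 : synthesis V₀ w.orthonormal_coe ψ₁' = 0 := by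
        refine hinj ((heq_zero _ ?_ (hw ψ₁')).trans (map_zero _).symm)
        rw [map_add] at hu
        exact (Submodule.add_mem_iff_right _ (hv ψ₁)).1 hu
      have h2 : synthesis V₀ v.orthonormal_coe ψ₂ = 0 := by
        refine hinj ((heq_zero _ (hv ψ₂) ?_).trans (map_zero _).symm)
        rw [map_add] at hu'
        exact (Submodule.add_mem_iff_left _ (hw ψ₂')).1 hu'
      rw [h1, h2, add_zero, zero_add]
      exact hasMatrixSum_unique
        (hasMatrixSum_synthesis a v.orthonormal_coe w.orthonormal_coe ψ₁ ψ₂') (h ψ₁ ψ₂')
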